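/- Let $p \in [1, \infty)$. For each $n \in \mathbb{Z}_{>0}$ let $(X_n, \mathcal{B}_n, \mu_n)$ be a probability space, let $d(n) \geq 2$ be an integer, and let $\rho_n \colon M_{d(n)}(\mathbb{C}) \to L(L^p(X_n, \mu_n))$ be a unital algebra homomorphism into the bounded operators. Let $(X, \mu) = \prod_{n} (X_n, \mu_n)$ be the product probability space. For $n \geq 0$ let $A_n \subseteq L(L^p(X, \mu))$ be the linear span of the operators $\rho_1(a_1) \otimes \cdots \otimes \rho_n(a_n) \otimes 1$ with $a_j \in M_{d(j)}(\mathbb{C})$, where $T_1 \otimes \cdots \otimes T_n \otimes 1$ is the unique bounded operator on $L^p(X, \mu)$ that sends $\xi_1 \otimes \cdots \otimes \xi_n \otimes \eta$ to $T_1 \xi_1 \otimes \cdots \otimes T_n \xi_n \otimes \eta$ for all $\xi_j \in L^p(X_j, \mu_j)$ and $\eta \in L^p\big(\prod_{j > n} X_j\big)$. Set $A(d, \rho) = \overline{\bigcup_{n} A_n}$ (norm closure). A unital representation $\rho$ of $M_d(\mathbb{C})$ on a Banach space has enough isometries if there is a finite subgroup $G$ of the invertible group of $M_d(\mathbb{C})$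 which acts irreducibly on $\mathbb{C}^d$ and satisfies $\|\rho(g)\| = 1$ for all $g \in G$. A unital representation $\rho$ of $M_d(\mathbb{C})$ on $L^p(Y, \nu)$ locally has enough isometries if there is an at most countable partition $Y = \coprod_{i \in I} Y_i$ into measurable sets of positive measure such that each subspace $L^p(Y_i, \nu) \subseteq L^p(Y, \nu)$ is $\rho$-invariant and, for each $i \in I$, the representation $a \mapsto \rho(a)|_{L^p(Y_i, \nu)}$ has enough isometries. Let $(Z, \nu)$ be a $\sigma$-finite measure space and let $A \subseteq L(L^p(Z, \nu))$ be a unital subalgebra which is isometrically isomorphic, as an algebra, to some $A(d, \rho)$ as above in which every $\rho_n$ locally has enough isometries. Then $A$ is algebraically simple: $A \neq 0$, and the only two-sided ideals of $A$, closed or not, are $0$ and $A$. -/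

import Mathlib

open MeasureTheory
open scoped ENNReal

universe u v

noncomputable section

namespace LpUHF

/-! ### Representations of matrix algebras with enough isometries -/

section Representations

variable {d : ℕ} {E : Type*} [NormedAddCommGroup E] [NormedSpace ℂ E]

/-- The restriction of a (unital) representation of `M_d` on `E` to an invariant subspace. -/
def restrictRep (ρ : Matrix (Fin d) (Fin d) ℂ →ₐ[ℂ] (E →L[ℂ] E)) (V : Submodule ℂ E)
    (hV : ∀ a, ∀ v ∈ V, ρ a v ∈ V) : Matrix (Fin d) (Fin d) ℂ →ₐ[ℂ] (V →L[ℂ] V) :=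
  AlgHom.ofLinearMap
    { toFun := fun a => (ρ a).restrict (hV a)
      map_add' := fun a b => by ext v; simp
      map_smul' := fun c a => by ext v; simp }
    (by ext v; simp)
    (fun a b => by ext v; simp)

/-- The natural action of a subgroup of `inv (M_d)` on `ℂ^d`. -/
def naturalRep (G : Subgroup (Matrix (Fin d) (Fin d) ℂ)ˣ) : Representation ℂ G (Fin d → ℂ) :=
  ((Matrix.toLinAlgEquiv' : Matrix (Fin d) (Fin d) ℂ ≃ₐ[ℂ] _) :
      Matrix (Fin d) (Fin d) ℂ →* ((Fin d → ℂ) →ₗ[ℂ] (Fin d → ℂ))).comp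
    ((Units.coeHom _).comp G.subtype)

/-- `ρ` has enough isometries: there is a finite subgroup `G` of `inv (M_d)` acting irreducibly
on `ℂ^d` such that `‖ρ g‖ = 1` for all `g ∈ G`. -/
def HasEnoughIsometries (ρ : Matrix (Fin d) (Fin d) ℂ →ₐ[ℂ] (E →L[ℂ] E)) : Prop :=
  ∃ G : Subgroup (Matrix (Fin d) (Fin d) ℂ)ˣ,
    Finite G ∧ (naturalRep G).IsIrreducible ∧
      ∀ g ∈ G, ‖ρ (g : Matrix (Fin d) (Fin d) ℂ)‖ = 1

end Representations

section LocalIsometries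

variable {X : Type*} [MeasurableSpace X] {p : ℝ≥0∞} [Fact (1 ≤ p)]

/-- The subspace `L^p(s, μ)` of `L^p(X, μ)`: the functions vanishing almost everywhere off `s`. -/
def lpOn (p : ℝ≥0∞) [Fact (1 ≤ p)] (μ : Measure X) (s : Set X) : Submodule ℂ (Lp ℂ p μ) where
  carrier := {f | ∀ᵐ x ∂μ, x ∉ s → f x = 0}
  zero_mem' := by
    filter_upwards [Lp.coeFn_zero ℂ p μ] with x hx _
    simpa using hx
  add_mem' := by
    intro f g hf hg
    change ∀ᵐ x ∂μ, x ∉ s → (f + g) x = 0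
    filter_upwards [Lp.coeFn_add f g, hf, hg] with x h h1 h2 hx
    rw [h, Pi.add_apply, h1 hx, h2 hx, add_zero]
  smul_mem' := by
    intro c f hf
    change ∀ᵐ x ∂μ, x ∉ s → (c • f) x = 0
    filter_upwards [Lp.coeFn_smul c f, hf] with x h h1 hx
    rw [h, Pi.smul_apply, h1 hx, smul_zero]

/-- `ρ` locally has enough isometries: there is an at most countable measurable partition of `X`
into sets of positive measure such that each `L^p(Y i, μ)` is invariant and the restriction of
`ρ` to each `L^p(Y i, μ)` has enough isometries. -/
def LocallyHasEnoughIsometries {d : ℕ} {μ : Measure X}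
    (ρ : Matrix (Fin d) (Fin d) ℂ →ₐ[ℂ] (Lp ℂ p μ →L[ℂ] Lp ℂ p μ)) : Prop :=
  ∃ (ι : Type) (_ : Countable ι) (Y : ι → Set X),
    (∀ i, MeasurableSet (Y i)) ∧ Pairwise (fun i j => Disjoint (Y i) (Y j)) ∧
    (⋃ i, Y i) = Set.univ ∧ (∀ i, 0 < μ (Y i)) ∧
    ∀ i, ∃ h : ∀ a, ∀ f ∈ lpOn p μ (Y i), ρ a f ∈ lpOn p μ (Y i),
      HasEnoughIsometries (restrictRep ρ (lpOn p μ (Y i)) h)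

end LocalIsometries

/-! ### Elementary tensors of functions and operators on infinite products -/

section Tensor

theorem memLp_mul_prod {α β : Type*} [MeasurableSpace α] [MeasurableSpace β] {p : ℝ≥0∞}
    {μ : Measure α} {ν : Measure β} [IsFiniteMeasure μ] [IsFiniteMeasure ν] {f : α → ℂ}
    {g : β → ℂ} (h0 : p ≠ 0) (hf : MemLp f p μ) (hg : MemLp g p ν) :
    MemLp (fun z : α × β => f z.1 * g z.2) p (μ.prod ν) := by
  by_cases hp : p = ∞
  · subst hp
    exact MemLp.mul (p := ∞) (q := ∞) (hg.comp_snd μ) (hf.comp_fst ν)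
  · have hm : AEStronglyMeasurable (fun z : α × β => f z.1 * g z.2) (μ.prod ν) :=
      hf.1.comp_fst.mul hg.1.comp_snd
    rw [← integrable_norm_rpow_iff hm h0 hp]
    have h1 := (integrable_norm_rpow_iff hf.1 h0 hp).2 hf
    have h2 := (integrable_norm_rpow_iff hg.1 h0 hp).2 hg
    refine (h1.mul_prod h2).congr (Filter.Eventually.of_forall fun z => ?_)
    simp [Real.mul_rpow]

theorem memLp_pi_prod {ι : Type*} [Fintype ι] {X : ι → Type*} [∀ i, MeasurableSpace (X i)]
    {p : ℝ≥0∞} {μ : ∀ i, Measure (X i)} [∀ i, IsProbabilityMeasure (μ i)] {f : ∀ i, X i → ℂ}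
    (h0 : p ≠ 0) (hf : ∀ i, MemLp (f i) p (μ i)) :
    MemLp (fun x : ∀ i, X i => ∏ i, f i (x i)) p (Measure.infinitePi μ) := by
  have he : ∀ i, MemLp (fun x : ∀ i, X i => f i (x i)) p (Measure.infinitePi μ) := fun i =>
    (hf i).comp_measurePreserving (measurePreserving_eval_infinitePi μ i)
  by_cases hp : p = ∞
  · subst hp
    simpa using MemLp.prod' (s := Finset.univ) (p := fun _ : ι => ∞) fun i _ => he i
  · have hm : AEStronglyMeasurable (fun x : ∀ i, X i => ∏ i, f i (x i))
        (Measure.infinitePi μ) :=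
      Finset.aestronglyMeasurable_fun_prod _ fun i _ => (he i).1
    rw [← integrable_norm_rpow_iff hm h0 hp]
    rw [Measure.infinitePi_eq_pi]
    have h1 := fun i => (integrable_norm_rpow_iff (hf i).1 h0 hp).2 (hf i)
    refine (Integrable.fintype_prod_dep h1).congr (Filter.Eventually.of_forall fun z => ?_)
    simp [Real.finsetProd_rpow]

variable {ι : Type*} {X : ι → Type*} [∀ i, MeasurableSpace (X i)]
  {p : ℝ≥0∞} [Fact (1 ≤ p)] {μ : ∀ i, Measure (X i)} [∀ i, IsProbabilityMeasure (μ i)]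

theorem measurePreserving_split [DecidableEq ι] (S : Finset ι) :
    MeasurePreserving (MeasurableEquiv.piEquivPiSubtypeProd X (fun i => i ∈ S))
      (Measure.infinitePi μ)
      ((Measure.infinitePi fun i : {i // i ∈ S} => μ i).prod
        (Measure.infinitePi fun i : {i // i ∉ S} => μ i)) := by
  refine MeasurePreserving.symm
    (MeasurableEquiv.piEquivPiSubtypeProd X (fun i => i ∈ S)).symm
    ⟨MeasurableEquiv.measurable _, ?_⟩
  apply Measure.eq_infinitePi
  intro s t ht
  rw [Measure.map_apply (MeasurableEquiv.measurable _)
    (MeasurableSet.pi s.countable_toSet fun i _ => ht i)]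
  have : (MeasurableEquiv.piEquivPiSubtypeProd X (fun i => i ∈ S)).symm ⁻¹' ((s : Set ι).pi t)
      = (((s.subtype (· ∈ S) : Finset {i // i ∈ S}) : Set {i // i ∈ S}).pi
          fun i => t i) ×ˢ
        (((s.subtype (· ∉ S) : Finset {i // i ∉ S}) : Set {i // i ∉ S}).pi
          fun i => t i) := by
    ext ⟨y, z⟩
    simp only [Set.mem_preimage, Set.mem_pi, Set.mem_prod, Finset.mem_coe, Finset.mem_subtype,
      Subtype.forall]
    constructor
    · intro h
      refine ⟨fun i hi his => ?_, fun i hi his => ?_⟩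
      · simpa [MeasurableEquiv.piEquivPiSubtypeProd, Equiv.piEquivPiSubtypeProd, hi] using h i his
      · simpa [MeasurableEquiv.piEquivPiSubtypeProd, Equiv.piEquivPiSubtypeProd, hi] using h i his
    · rintro ⟨h1, h2⟩ i his
      by_cases hi : i ∈ S
      · simpa [MeasurableEquiv.piEquivPiSubtypeProd, Equiv.piEquivPiSubtypeProd, hi] using
          h1 i hi his
      · simpa [MeasurableEquiv.piEquivPiSubtypeProd, Equiv.piEquivPiSubtypeProd, hi] using
          h2 i hi his
  have h1 := Measure.infinitePi_pi (fun i : {i // i ∈ S} => μ i) (s := s.subtype (· ∈ S))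
    (t := fun i => t i) fun i _ => ht i
  have h2 := Measure.infinitePi_pi (fun i : {i // i ∉ S} => μ i) (s := s.subtype (· ∉ S))
    (t := fun i => t i) fun i _ => ht i
  rw [this, Measure.prod_prod, h1, h2,
    Finset.prod_subtype_eq_prod_filter (s := s) (p := (· ∈ S)) (f := fun i => μ i (t i)),
    Finset.prod_subtype_eq_prod_filter (s := s) (p := (· ∉ S)) (f := fun i => μ i (t i)),
    Finset.prod_filter_mul_prod_filter_not]

theorem memLp_tensor (S : Finset ι) (ξ : ∀ i : {i // i ∈ S}, Lp ℂ p (μ i))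
    (η : Lp ℂ p (Measure.infinitePi fun i : {i // i ∉ S} => μ i)) :
    MemLp (fun x : ∀ i, X i => (∏ i : {i // i ∈ S}, ξ i (x i)) * η (fun i => x i)) p
      (Measure.infinitePi μ) := by
  classical
  have h0 : p ≠ 0 := (zero_lt_one.trans_le (Fact.out : 1 ≤ p)).ne'
  have h1 : MemLp (fun y : ∀ i : {i // i ∈ S}, X i => ∏ i : {i // i ∈ S}, ξ i (y i)) p
      (Measure.infinitePi fun i : {i // i ∈ S} => μ i) :=
    memLp_pi_prod (X := fun i : {i // i ∈ S} => X i) (μ := fun i : {i // i ∈ S} => μ i)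
      (f := fun i => (ξ i : X i → ℂ)) h0 fun i => Lp.memLp (ξ i)
  have h2 := memLp_mul_prod h0 h1 (Lp.memLp η)
  have h3 := h2.comp_measurePreserving (measurePreserving_split (μ := μ) S)
  refine h3.ae_eq (Filter.Eventually.of_forall fun x => ?_)
  rfl

/-- For finite `S`, the elementary tensor `(⨂_{i ∈ S} ξ i) ⊗ η` in `L^p(∏ X i)`, that is, the
class of `x ↦ (∏_{i ∈ S} ξ i (x i)) * η (x restricted to the complement of S)`. -/
def tensorVec (S : Finset ι) (ξ : ∀ i : {i // i ∈ S}, Lp ℂ p (μ i))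
    (η : Lp ℂ p (Measure.infinitePi fun i : {i // i ∉ S} => μ i)) :
    Lp ℂ p (Measure.infinitePi μ) :=
  (memLp_tensor S ξ η).toLp _

/-- The bounded operator `c` on `L^p(∏ X i)` is the elementary tensor `(⨂_{i ∈ S} T i) ⊗ 1`.
(The elementary tensors of functions are total in `L^p(∏ X i)` when `p ≠ ∞`, so there is at most
one such `c`.) -/
def IsTensorOp (S : Finset ι) (T : ∀ i : {i // i ∈ S}, Lp ℂ p (μ i) →L[ℂ] Lp ℂ p (μ i))
    (c : Lp ℂ p (Measure.infinitePi μ) →L[ℂ] Lp ℂ p (Measure.infinitePi μ)) : Prop :=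
  ∀ ξ η, c (tensorVec S ξ η) = tensorVec S (fun i => T i (ξ i)) η

theorem IsTensorOp.one (S : Finset ι) :
    IsTensorOp S (fun _ => 1) (1 : Lp ℂ p (Measure.infinitePi μ) →L[ℂ] _) :=
  fun _ _ => rfl

theorem IsTensorOp.mul {S : Finset ι}
    {T T' : ∀ i : {i // i ∈ S}, Lp ℂ p (μ i) →L[ℂ] Lp ℂ p (μ i)}
    {c c' : Lp ℂ p (Measure.infinitePi μ) →L[ℂ] Lp ℂ p (Measure.infinitePi μ)}
    (h : IsTensorOp S T c) (h' : IsTensorOp S T' c') :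
    IsTensorOp S (fun i => T i * T' i) (c * c') := by
  intro ξ η
  change c (c' (tensorVec S ξ η)) = _
  rw [h' ξ η, h]
  rfl

end Tensor

/-! ### `L^p` UHF algebras of infinite tensor product type -/

/-- The ingredients of the construction: probability spaces `(X n, μ n)`, integers `d n ≥ 2`, and
unital representations `ρ n` of `M_{d n}` on `L^p(X n, μ n)`. -/
structure TensorData (p : ℝ≥0∞) [Fact (1 ≤ p)] where
  X : ℕ → Type v
  [measurableSpace : ∀ n, MeasurableSpace (X n)]
  μ : ∀ n, Measure (X n)
  [prob : ∀ n, IsProbabilityMeasure (μ n)]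
  d : ℕ → ℕ
  two_le_d : ∀ n, 2 ≤ d n
  ρ : ∀ n, Matrix (Fin (d n)) (Fin (d n)) ℂ →ₐ[ℂ] (Lp ℂ p (μ n) →L[ℂ] Lp ℂ p (μ n))

attribute [instance] TensorData.measurableSpace TensorData.prob

namespace TensorData

variable {p : ℝ≥0∞} [Fact (1 ≤ p)] (D : TensorData p)

/-- `L^p` of the infinite product probability space. -/
abbrev LpProd : Type _ := Lp ℂ p (Measure.infinitePi D.μ)

/-- The elementary tensors `(⨂_{n ∈ S} ρ n (a n)) ⊗ 1` with `a n ∈ M_{d n}`. -/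
def elementary (S : Finset ℕ) : Set (D.LpProd →L[ℂ] D.LpProd) :=
  {c | ∃ a : ∀ n : {n // n ∈ S}, Matrix (Fin (D.d n)) (Fin (D.d n)) ℂ,
    IsTensorOp S (fun n => D.ρ n (a n)) c}

/-- The finite stage `A_S`: the image of `⨂_{n ∈ S} M_{d n}` under the tensor product of the `ρ n`,
acting on `L^p` of the infinite product. It is the linear span of the elementary tensors. -/
def stage (S : Finset ℕ) : Subalgebra ℂ (D.LpProd →L[ℂ] D.LpProd) :=
  (Submodule.span ℂ (D.elementary S)).toSubalgebra
    (Submodule.subset_span ⟨fun _ => 1, by simpa using IsTensorOp.one S⟩)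
    (by
      intro x y hx hy
      have := Submodule.mul_mem_mul hx hy
      rw [Submodule.span_mul_span] at this
      refine Submodule.span_mono ?_ this
      rintro _ ⟨c, ⟨a, ha⟩, c', ⟨b, hb⟩, rfl⟩
      exact ⟨fun n => a n * b n, by simpa using ha.mul hb⟩)

/-- The algebra `A(d, ρ)`: the norm closure of the increasing union of the finite stages
`A_S` with `S = {0, …, n - 1}`, as an algebra of operators on `L^p` of the infinite product. -/
def algebra : Subalgebra ℂ (D.LpProd →L[ℂ] D.LpProd) :=
  (⨆ n : ℕ, D.stage (Finset.range n)).topologicalClosure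

end TensorData

/-- `A ⊆ L(L^p(Z, ν))` is an `L^p` UHF algebra of tensor product type which locally has enough
isometries: it is isometrically isomorphic to some `A(d, ρ)` in which every `ρ n` locally has
enough isometries. -/
def IsTensorUHFLocallyEnoughIsometries {Z : Type u} [MeasurableSpace Z] {ν : Measure Z}
    {p : ℝ≥0∞} [Fact (1 ≤ p)] (A : Subalgebra ℂ (Lp ℂ p ν →L[ℂ] Lp ℂ p ν)) : Prop :=
  ∃ D : TensorData.{v} p, (∀ n, LocallyHasEnoughIsometries (D.ρ n)) ∧
    ∃ e : A ≃ₐ[ℂ] D.algebra, Isometry e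

end LpUHF

end

/-! Let `π` embed a matrix algebra in a ring, with matrix units `e_ij`. Then every `x` is `∑ c_ij(x)
e_ij`, where the coefficients `c_ij(x) = ∑_s e_si x e_js` (`matCoeff`) commute with the range of
`π`. The normalised trace `E(x) = d⁻¹ ∑ c_ii(x)` (`matAvg`) is a projection onto the commutant and
maps each two-sided ideal into itself.

The key point is that `E` is also the average of `π(g) x π(g)⁻¹` over any finite irreducible group
`G` of matrices (`avg_conj_map_eq`, from Schur's lemma). If `G` acts by isometries, `E` is therefore
contractive. When there are enough isometries only locally, the group changes from piece to piece,
but `E` does not depend on the group. The operators of `A(d, ρ)` preserve the pieces, and the norm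
of a block diagonal operator on an `ℓ^p` sum is controlled by its blocks, so `E` is still
contractive on `A(d, ρ)` (`norm_matAvg_le`).

Simplicity follows in `isSimpleRing_of_matTower`. Given `a ≠ 0` in an ideal `I`, take `b` in a
finite stage close to `a`. Averaging over more and more of the later matrix algebras fixes `b` and,
by density and contractivity, sends `a` to a limit `c` in the same stage. This `c` lies in the
closure of `I` and is nonzero because it is still close to `b`. A nonzero element of a finite stage
generates the unit ideal (`eq_top_of_mem_matTower`), so `I` is dense; a proper ideal of a Banach
algebra never is. Hence `I` need not be closed.

The analytic input is the operator `T ⊗ 1` with norm at most `‖T‖`, which rests on Fubini and on the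
totality of elementary tensors for `p < ∞`. -/

noncomputable section

namespace LpUHF

/-! ### Coefficients relative to a system of matrix units. -/

section MatrixUnits

variable {d : ℕ} {A : Type*} [Ring A] [Algebra ℂ A]
  (π : Matrix (Fin d) (Fin d) ℂ →ₐ[ℂ] A)

theorem map_single_mul_map_single (i j k l : Fin d) :
    π (Matrix.single i j 1) * π (Matrix.single k l 1)
      = if j = k then π (Matrix.single i l 1) else 0 := by
  rw [← map_mul]
  split_ifs with h
  · subst h; simp
  · rw [Matrix.single_mul_single_of_ne _ _ _ _ h, map_zero]

theorem sum_map_single_self : ∑ i, π (Matrix.single i i 1) = 1 := by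
  rw [← map_sum, Matrix.sum_single_one, map_one]

/-- The coefficient of `x` at the matrix unit `(i, j)`, in the commutant of the range of `π`. -/
def matCoeff (i j : Fin d) : A →ₗ[ℂ] A :=
  ∑ s, (LinearMap.mulLeft ℂ (π (Matrix.single s i 1))).comp
    (LinearMap.mulRight ℂ (π (Matrix.single j s 1)))

theorem matCoeff_apply (i j : Fin d) (x : A) :
    matCoeff π i j x = ∑ s, π (Matrix.single s i 1) * x * π (Matrix.single j s 1) := by
  simp [matCoeff, LinearMap.sum_apply, mul_assoc]

/-- Multiplying by `e_ij` on the right kills all but one term of the coefficient and leaves `e_ii x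
e_jj`; the diagonal units sum to 1. -/
theorem sum_matCoeff_mul (x : A) :
    ∑ i, ∑ j, matCoeff π i j x * π (Matrix.single i j 1) = x := by
  have : ∀ i j, matCoeff π i j x * π (Matrix.single i j 1)
      = π (Matrix.single i i 1) * x * π (Matrix.single j j 1) := by
    intro i j
    simp [matCoeff_apply, Finset.sum_mul, mul_assoc, map_single_mul_map_single]
  simp_rw [this, ← Finset.mul_sum, ← Finset.sum_mul, sum_map_single_self, one_mul, mul_one]

/-- Coefficients multiply as matrix entries because `e_ls e_tl` vanishes for `s ≠ t`. This is what
makes `matExtend` closed under products. -/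
theorem matCoeff_mul (i j : Fin d) (x y : A) :
    matCoeff π i j (x * y) = ∑ l, matCoeff π i l x * matCoeff π l j y := by
  have h : ∀ l, matCoeff π i l x * matCoeff π l j y
      = ∑ s, π (Matrix.single s i 1) * x * π (Matrix.single l l 1) * y *
          π (Matrix.single j s 1) := by
    intro l
    simp only [matCoeff_apply, Finset.sum_mul, Finset.mul_sum]
    refine Finset.sum_congr rfl fun s _ => ?_
    rw [Finset.sum_eq_single s]
    · have := map_single_mul_map_single π l s s l
      rw [if_pos rfl] at this
      rw [← this]; simp only [mul_assoc]
    · intro t _ hts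
      have := map_single_mul_map_single π l t s l
      rw [if_neg hts] at this
      calc _ = π (Matrix.single t i 1) * x *
            (π (Matrix.single l t 1) * π (Matrix.single s l 1)) * y * π (Matrix.single j s 1) := by
              simp only [mul_assoc]
        _ = 0 := by rw [this]; simp
    · simp
  simp_rw [h]
  rw [Finset.sum_comm, matCoeff_apply]
  refine Finset.sum_congr rfl fun s _ => ?_
  simp_rw [← Finset.sum_mul, ← Finset.mul_sum, sum_map_single_self]
  simp [mul_assoc]

theorem matCoeff_of_commute {x : A} (hx : ∀ b, Commute x (π b)) (i j : Fin d) :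
    matCoeff π i j x = if i = j then x else 0 := by
  have : ∀ s, π (Matrix.single s i 1) * x * π (Matrix.single j s 1)
      = if i = j then x * π (Matrix.single s s 1) else 0 := by
    intro s
    rw [← (hx _).eq, mul_assoc, map_single_mul_map_single]
    split_ifs <;> simp
  rw [matCoeff_apply, Finset.sum_congr rfl fun s _ => this s]
  split_ifs
  · rw [← Finset.mul_sum, sum_map_single_self, mul_one]
  · simp

theorem matCoeff_map (i j : Fin d) (b : Matrix (Fin d) (Fin d) ℂ) :
    matCoeff π i j (π b) = algebraMap ℂ A (b i j) := by
  have : ∀ s, π (Matrix.single s i 1) * π b * π (Matrix.single j s 1)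
      = b i j • π (Matrix.single s s 1) := by
    intro s
    rw [← map_mul, ← map_mul, ← map_smul]
    congr 1
    ext k l
    simp [Matrix.single_mul_mul_single, Matrix.single_apply]
  rw [matCoeff_apply, Finset.sum_congr rfl fun s _ => this s, ← Finset.smul_sum,
    sum_map_single_self, Algebra.algebraMap_eq_smul_one]

/-- The average of `x` over the commutant of the range of `π`. -/
def matAvg : A →ₗ[ℂ] A := (d : ℂ)⁻¹ • ∑ i, matCoeff π i i

theorem matAvg_apply (x : A) : matAvg π x = (d : ℂ)⁻¹ • ∑ i, matCoeff π i i x := by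
  simp [matAvg, LinearMap.sum_apply]

theorem matAvg_of_commute (hd : d ≠ 0) {x : A} (hx : ∀ b, Commute x (π b)) :
    matAvg π x = x := by
  rw [matAvg_apply]
  simp only [matCoeff_of_commute π hx, if_true, Finset.sum_const, Finset.card_univ,
    Fintype.card_fin]
  rw [← Nat.cast_smul_eq_nsmul ℂ, smul_smul, inv_mul_cancel₀ (by exact_mod_cast hd), one_smul]

/-- The elements whose coefficients relative to `π` lie in the subalgebra `S`. -/
def matExtend (S : Subalgebra ℂ A) : Subalgebra ℂ A where
  carrier := {x | ∀ i j, matCoeff π i j x ∈ S}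
  mul_mem' := by
    intro x y hx hy i j
    rw [matCoeff_mul]
    exact S.sum_mem fun l _ => S.mul_mem (hx i l) (hy l j)
  add_mem' := by
    intro x y hx hy i j
    rw [map_add]
    exact S.add_mem (hx i j) (hy i j)
  algebraMap_mem' := by
    intro r i j
    rw [matCoeff_of_commute π fun b => Algebra.commute_algebraMap_left r _]
    split_ifs
    · exact S.algebraMap_mem r
    · exact S.zero_mem

theorem mem_matExtend {S : Subalgebra ℂ A} {x : A} :
    x ∈ matExtend π S ↔ ∀ i j, matCoeff π i j x ∈ S := Iff.rfl

theorem map_mem_matExtend (S : Subalgebra ℂ A) (b : Matrix (Fin d) (Fin d) ℂ) :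
    π b ∈ matExtend π S := fun i j => by
  rw [matCoeff_map]; exact S.algebraMap_mem _

theorem mem_matExtend_of_commute {S : Subalgebra ℂ A} {x : A} (hS : x ∈ S)
    (hx : ∀ b, Commute x (π b)) : x ∈ matExtend π S := fun i j => by
  rw [matCoeff_of_commute π hx]
  split_ifs
  · exact hS
  · exact S.zero_mem

theorem matAvg_mem_of_mem_matExtend {S : Subalgebra ℂ A} {x : A} (hx : x ∈ matExtend π S) :
    matAvg π x ∈ S := by
  rw [matAvg_apply]
  exact S.smul_mem (S.sum_mem fun i _ => hx i i) _

end MatrixUnits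

/-! ### Towers of commuting matrix algebras and the simplicity criterion. -/

section MatrixTower

variable {d : ℕ → ℕ} {A : Type*} [NormedRing A] [NormedAlgebra ℂ A]
  (π : ∀ n, Matrix (Fin (d n)) (Fin (d n)) ℂ →ₐ[ℂ] A)

/-- The subalgebra generated by the ranges of `π 0, …, π (n - 1)` when these commute. -/
def matTower : ℕ → Subalgebra ℂ A
  | 0 => ⊥
  | n + 1 => matExtend (π n) (matTower n)

variable (hcomm : ∀ m n, m ≠ n → ∀ a b, Commute (π m a) (π n b))

include hcomm in
theorem commute_of_mem_matTower {n : ℕ} {x : A} (hx : x ∈ matTower π n) {k : ℕ} (hk : n ≤ k)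
    (b : Matrix (Fin (d k)) (Fin (d k)) ℂ) : Commute x (π k b) := by
  induction n generalizing x with
  | zero =>
    obtain ⟨r, rfl⟩ := Algebra.mem_bot.1 hx
    exact Algebra.commute_algebraMap_left r _
  | succ n ih =>
    rw [← sum_matCoeff_mul (π n) x]
    refine Commute.sum_left _ _ _ fun i _ => Commute.sum_left _ _ _ fun j _ => ?_
    exact (ih (hx i j) (by omega)).mul_left (hcomm n k (by omega) _ _)

include hcomm in
-- An element of stage `n` commutes with the range of `π n`, so its coefficient matrix is itself on
-- the diagonal and zero elsewhere.
theorem matTower_mono : Monotone (matTower π) :=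
  monotone_nat_of_le_succ fun _ _ hx =>
    mem_matExtend_of_commute _ hx (commute_of_mem_matTower π hcomm hx le_rfl)

include hcomm in
theorem map_mem_matTower {k n : ℕ} (h : k < n) (b : Matrix (Fin (d k)) (Fin (d k)) ℂ) :
    π k b ∈ matTower π n :=
  matTower_mono π hcomm h (map_mem_matExtend (π k) (matTower π k) b)

theorem continuous_matCoeff {d : ℕ} (π : Matrix (Fin d) (Fin d) ℂ →ₐ[ℂ] A) (i j : Fin d) :
    Continuous (matCoeff π i j) := by
  simp_rw [funext (matCoeff_apply π i j)]
  fun_prop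

/-- Each stage is cut out by continuous coefficient maps from the preceding one, down to the
scalars. Limits of averages therefore stay in the stage. -/
theorem isClosed_matTower (n : ℕ) : IsClosed (matTower π n : Set A) := by
  induction n with
  | zero =>
    have : ((⊥ : Subalgebra ℂ A) : Set A) = (Submodule.span ℂ {(1 : A)} : Set A) := by
      rw [← Algebra.toSubmodule_bot.trans Submodule.one_eq_span]; rfl
    change IsClosed ((⊥ : Subalgebra ℂ A) : Set A)
    rw [this]
    exact Submodule.closed_of_finiteDimensional _
  | succ n ih =>
    have : (matTower π (n + 1) : Set A) = ⋂ i, ⋂ j, matCoeff (π n) i j ⁻¹' matTower π n := by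
      ext x; simp [matTower, mem_matExtend]
    rw [this]
    exact isClosed_iInter fun i => isClosed_iInter fun j =>
      ih.preimage (continuous_matCoeff (π n) i j)

theorem matCoeff_mem_ideal {d : ℕ} (π : Matrix (Fin d) (Fin d) ℂ →ₐ[ℂ] A) {J : Ideal A}
    (hJ : J.IsTwoSided) {x : A} (hx : x ∈ J) (i j : Fin d) : matCoeff π i j x ∈ J := by
  rw [matCoeff_apply]
  exact J.sum_mem fun s _ => J.mul_mem_right _ (J.mul_mem_left _ hx)

theorem smul_mem_ideal {J : Ideal A} {x : A} (hx : x ∈ J) (c : ℂ) : c • x ∈ J := by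
  rw [Algebra.smul_def]; exact J.mul_mem_left _ hx

/-- The coefficients of an element of `J` are again in `J`, and one of them is nonzero. Descending
through the stages ends at a nonzero scalar in `J`. -/
theorem eq_top_of_mem_matTower {J : Ideal A} (hJ : J.IsTwoSided) {n : ℕ} {x : A}
    (hx : x ∈ matTower π n) (hxJ : x ∈ J) (h0 : x ≠ 0) : J = ⊤ := by
  induction n generalizing x with
  | zero =>
    obtain ⟨r, rfl⟩ := Algebra.mem_bot.1 hx
    have hr : r ≠ 0 := by rintro rfl; simp at h0
    refine J.eq_top_iff_one.2 ?_
    have := smul_mem_ideal hxJ r⁻¹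
    rwa [Algebra.algebraMap_eq_smul_one, smul_smul, inv_mul_cancel₀ hr, one_smul] at this
  | succ n ih =>
    by_contra hne
    apply h0
    rw [← sum_matCoeff_mul (π n) x]
    refine Finset.sum_eq_zero fun i _ => Finset.sum_eq_zero fun j _ => ?_
    have : matCoeff (π n) i j x = 0 := by
      by_contra h
      exact hne (ih (hx i j) (matCoeff_mem_ideal _ hJ hxJ i j) h)
    rw [this, zero_mul]

/-- The successive averages over the ranges of `π n, …, π (n + k - 1)`. -/
def towerAvg (n : ℕ) : ℕ → A →ₗ[ℂ] A
  | 0 => LinearMap.id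
  | k + 1 => (towerAvg n k).comp (matAvg (π (n + k)))

theorem towerAvg_succ (n k : ℕ) (x : A) :
    towerAvg π n (k + 1) x = towerAvg π n k (matAvg (π (n + k)) x) := rfl

theorem norm_towerAvg_le (hc : ∀ n x, ‖matAvg (π n) x‖ ≤ ‖x‖) (n k : ℕ) (x : A) :
    ‖towerAvg π n k x‖ ≤ ‖x‖ := by
  induction k generalizing x with
  | zero => exact le_rfl
  | succ k ih => exact (ih _).trans (hc _ _)

theorem towerAvg_mem_matTower (n k : ℕ) {x : A} (hx : x ∈ matTower π (n + k)) :
    towerAvg π n k x ∈ matTower π n := by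
  induction k generalizing x with
  | zero => exact hx
  | succ k ih => exact ih (matAvg_mem_of_mem_matExtend _ hx)

theorem towerAvg_mem_ideal {J : Ideal A} (hJ : J.IsTwoSided) (n k : ℕ) {x : A} (hx : x ∈ J) :
    towerAvg π n k x ∈ J := by
  induction k generalizing x with
  | zero => exact hx
  | succ k ih =>
    refine ih ?_
    rw [matAvg_apply]
    exact smul_mem_ideal (J.sum_mem fun i _ => matCoeff_mem_ideal _ hJ hx i i) _

include hcomm in
-- The average of highest index is applied first, and `x` commutes with every matrix algebra of
-- index at least `n + k`, so the extra averages fix `x` before the others act.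
theorem towerAvg_add (hd : ∀ n, d n ≠ 0) (n k l : ℕ) {x : A} (hx : x ∈ matTower π (n + k)) :
    towerAvg π n (k + l) x = towerAvg π n k x := by
  induction l with
  | zero => rfl
  | succ l ih =>
    rw [← add_assoc, towerAvg_succ, matAvg_of_commute _ (hd _), ih]
    exact commute_of_mem_matTower π hcomm hx (by omega)

include hcomm in
/-- A Banach algebra with a dense union of commuting matrix algebras whose averages are
contractive is algebraically simple. -/
theorem isSimpleRing_of_matTower [CompleteSpace A] [Nontrivial A] (hd : ∀ n, d n ≠ 0)
    (hc : ∀ n x, ‖matAvg (π n) x‖ ≤ ‖x‖)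
    (hdense : Dense (⋃ n, (matTower π n : Set A))) : IsSimpleRing A := by
  rw [isSimpleRing_iff_isTwoSided_imp]
  refine ⟨inferInstance, fun I hI => or_iff_not_imp_left.2 fun hbot => ?_⟩
  obtain ⟨a, haI, ha0⟩ := Submodule.exists_mem_ne_zero_of_ne_bot hbot
  have hJ : I.closure.IsTwoSided := ⟨fun {x} b hx => by
    rw [← SetLike.mem_coe, Ideal.coe_closure] at hx ⊢
    exact map_mem_closure (f := fun y => y * b) (by fun_prop) hx fun y hy =>
      I.mul_mem_right b hy⟩
  by_contra hI'
  -- Proper ideals of a Banach algebra are not dense, so it is enough to show that the closure of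
  -- `I` is everything.
  refine Ideal.closure_ne_top I hI' ?_
  have approx : ∀ ε > 0, ∃ n, ∃ b ∈ matTower π n, ‖a - b‖ < ε := by
    intro ε hε
    obtain ⟨b, hb, hab⟩ := Metric.mem_closure_iff.1 (hdense a) ε hε
    obtain ⟨n, hn⟩ := Set.mem_iUnion.1 hb
    exact ⟨n, b, hn, by rwa [dist_eq_norm] at hab⟩
  have ha : 0 < ‖a‖ := norm_pos_iff.2 ha0
  -- Any fraction below one half would do: if the limit were 0, then `‖b‖ ≤ ‖a‖ / 4`, whence `‖a‖ ≤
  -- ‖b‖ + ‖a - b‖ < ‖a‖`.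
  obtain ⟨n, b, hb, hab⟩ := approx (‖a‖ / 4) (by positivity)
  -- Averages of an approximant `z` in stage `n + N` are constant from `N` on, and contractivity
  -- transfers this to `a` up to `ε`. This yields both the Cauchy property and a limit in stage `n`.
  have hnear : ∀ ε > 0, ∃ K, ∃ y ∈ matTower π n, ∀ k ≥ K, ‖towerAvg π n k a - y‖ < ε := by
    intro ε hε
    obtain ⟨N, z, hz, haz⟩ := approx ε hε
    have hz' : z ∈ matTower π (n + N) := matTower_mono π hcomm (by omega) hz
    refine ⟨N, _, towerAvg_mem_matTower π n N hz', fun k hk => ?_⟩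
    obtain ⟨l, rfl⟩ := Nat.exists_eq_add_of_le hk
    rw [← towerAvg_add π hcomm hd n N l hz', ← map_sub]
    exact (norm_towerAvg_le π hc _ _ _).trans_lt haz
  have hcau : CauchySeq fun k => towerAvg π n k a := by
    rw [Metric.cauchySeq_iff']
    intro ε hε
    obtain ⟨K, y, -, hy⟩ := hnear (ε / 2) (by positivity)
    refine ⟨K, fun k hk => ?_⟩
    have h1 := hy k hk
    have h2 := hy K le_rfl
    rw [← dist_eq_norm] at h1 h2
    exact (dist_triangle_right _ _ y).trans_lt (by linarith)
  obtain ⟨c, hlim⟩ := cauchySeq_tendsto_of_complete hcau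
  have hcn : c ∈ matTower π n := by
    rw [← SetLike.mem_coe, ← (isClosed_matTower π n).closure_eq, Metric.mem_closure_iff]
    intro ε hε
    obtain ⟨K, y, hyn, hy⟩ := hnear (ε / 2) (by positivity)
    refine ⟨y, hyn, ?_⟩
    rw [dist_eq_norm]
    refine lt_of_le_of_lt (le_of_tendsto (hlim.sub_const y).norm ?_) (half_lt_self hε)
    filter_upwards [Filter.eventually_ge_atTop K] with k hk using (hy k hk).le
  have hcJ : c ∈ I.closure := by
    rw [← SetLike.mem_coe, Ideal.coe_closure]
    exact mem_closure_of_tendsto hlim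
      (Filter.Eventually.of_forall fun k => towerAvg_mem_ideal π hI n k haI)
  refine eq_top_of_mem_matTower π hJ hcn hcJ ?_
  rintro rfl
  have hle : ‖(0 : A) - b‖ ≤ ‖a‖ / 4 := by
    refine le_of_tendsto (hlim.sub_const b).norm (Filter.Eventually.of_forall fun k => ?_)
    have : towerAvg π n k b = b := by
      simpa [towerAvg] using towerAvg_add π hcomm hd n 0 k (x := b) hb
    rw [← this, ← map_sub]
    exact (norm_towerAvg_le π hc _ _ _).trans hab.le
  rw [zero_sub, norm_neg] at hle
  have := norm_le_norm_add_norm_sub' a b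
  linarith

end MatrixTower

/-! ### Schur's lemma and averages over irreducible finite groups. -/

section Schur

variable {d : ℕ}

theorem exists_eq_scalar_of_commute {G : Subgroup (Matrix (Fin d) (Fin d) ℂ)ˣ}
    (hG : (naturalRep G).IsIrreducible) (x : Matrix (Fin d) (Fin d) ℂ)
    (hx : ∀ g ∈ G, (g : Matrix (Fin d) (Fin d) ℂ) * x = x * g) :
    ∃ c : ℂ, x = c • 1 := by
  let f : Representation.IntertwiningMap (naturalRep G) (naturalRep G) :=
    ⟨Matrix.toLin' x, fun g => by
      have := hx g g.2
      change Matrix.toLin' x ∘ₗ Matrix.toLin' ((g : (Matrix (Fin d) (Fin d) ℂ)ˣ) : Matrix (Fin d) (Fin d) ℂ)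
        = Matrix.toLin' ((g : (Matrix (Fin d) (Fin d) ℂ)ˣ) : Matrix (Fin d) (Fin d) ℂ) ∘ₗ Matrix.toLin' x
      rw [← Matrix.toLin'_mul, ← Matrix.toLin'_mul, this]⟩
  have := hG
  obtain ⟨c, hc⟩ :=
    (Representation.IsIrreducible.algebraMap_intertwiningMap_bijective_of_isAlgClosed
      (ρ := naturalRep G)).2 f
  refine ⟨c, Matrix.toLin'.injective ?_⟩
  have := congrArg Representation.IntertwiningMap.toLinearMap hc
  rw [map_smul, Matrix.toLin'_one]
  exact this.symm

/-- The average commutes with `G`, hence is scalar by Schur's lemma; conjugation preserves the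
trace, which determines the scalar. -/
theorem avg_conj_eq {G : Subgroup (Matrix (Fin d) (Fin d) ℂ)ˣ} [Fintype G]
    (hG : (naturalRep G).IsIrreducible) (x : Matrix (Fin d) (Fin d) ℂ) :
    ((Fintype.card G : ℂ)⁻¹ • ∑ g : G, ((g : (Matrix (Fin d) (Fin d) ℂ)ˣ) :
        Matrix (Fin d) (Fin d) ℂ) * x * (((g⁻¹ : G) : (Matrix (Fin d) (Fin d) ℂ)ˣ) : Matrix (Fin d) (Fin d) ℂ))
      = ((d : ℂ)⁻¹ * x.trace) • 1 := by
  set y := (Fintype.card G : ℂ)⁻¹ • ∑ g : G, ((g : (Matrix (Fin d) (Fin d) ℂ)ˣ) :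
        Matrix (Fin d) (Fin d) ℂ) * x * ((g⁻¹ : G) : (Matrix (Fin d) (Fin d) ℂ)ˣ) with hy
  have hcard : (Fintype.card G : ℂ) ≠ 0 := by exact_mod_cast Fintype.card_ne_zero
  -- For `d = 0` the space is zero and has a single subrepresentation, which irreducibility
  -- excludes.
  have hd : (d : ℂ) ≠ 0 := by
    rintro h
    have h0 : d = 0 := by exact_mod_cast h
    subst h0
    obtain ⟨V, W, hVW⟩ := hG.toNontrivial
    refine hVW ?_
    ext v
    have : v = 0 := Subsingleton.elim _ _
    subst this
    exact ⟨fun _ => W.toSubmodule.zero_mem, fun _ => V.toSubmodule.zero_mem⟩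
  obtain ⟨c, hc⟩ := exists_eq_scalar_of_commute hG y (by
    intro h hh
    rw [hy, mul_smul_comm, smul_mul_assoc, Finset.mul_sum, Finset.sum_mul]
    congr 1
    refine Fintype.sum_equiv (Equiv.mulLeft (⟨h, hh⟩ : G)) _ _ fun g => ?_
    simp [mul_assoc])
  have htr : y.trace = x.trace := by
    rw [hy, Matrix.trace_smul, Matrix.trace_sum]
    have : ∀ g : G, Matrix.trace (((g : (Matrix (Fin d) (Fin d) ℂ)ˣ) :
        Matrix (Fin d) (Fin d) ℂ) * x * (((g⁻¹ : G) : (Matrix (Fin d) (Fin d) ℂ)ˣ) : Matrix (Fin d) (Fin d) ℂ)) = x.trace := by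
      intro g
      rw [Matrix.trace_mul_comm, ← mul_assoc]
      simp
    rw [Finset.sum_congr rfl fun g _ => this g]
    simp [hcard]
  rw [hc, Matrix.trace_smul, Matrix.trace_one, Fintype.card_fin, smul_eq_mul] at htr
  rw [hc, ← htr]
  congr 1
  field_simp

variable {A : Type*} [Ring A] [Algebra ℂ A]

/-- Multiplying the coefficient by `e_kl` on either side gives `e_ki x e_jl`, and the matrix units
span. -/
theorem commute_matCoeff (π : Matrix (Fin d) (Fin d) ℂ →ₐ[ℂ] A) (i j : Fin d) (x : A)
    (b : Matrix (Fin d) (Fin d) ℂ) : Commute (matCoeff π i j x) (π b) := by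
  have hunit : ∀ k l, Commute (matCoeff π i j x) (π (Matrix.single k l 1)) := by
    intro k l
    have h1 : matCoeff π i j x * π (Matrix.single k l 1)
        = π (Matrix.single k i 1) * x * π (Matrix.single j l 1) := by
      simp [matCoeff_apply, Finset.sum_mul, mul_assoc, map_single_mul_map_single]
    have h2 : π (Matrix.single k l 1) * matCoeff π i j x
        = π (Matrix.single k i 1) * x * π (Matrix.single j l 1) := by
      simp [matCoeff_apply, Finset.mul_sum, ← mul_assoc, map_single_mul_map_single]
    exact h1.trans h2.symm
  rw [Matrix.matrix_eq_sum_single b, map_sum]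
  refine Commute.sum_right _ _ _ fun k _ => ?_
  rw [map_sum]
  refine Commute.sum_right _ _ _ fun l _ => ?_
  have : Matrix.single k l (b k l) = b k l • Matrix.single k l (1 : ℂ) := by
    rw [Matrix.smul_single, smul_eq_mul, mul_one]
  rw [this, map_smul]
  exact (hunit k l).smul_right _

/-- The average over conjugation by an irreducible finite group of matrices is the average over
matrix units. -/
theorem avg_conj_map_eq {G : Subgroup (Matrix (Fin d) (Fin d) ℂ)ˣ} [Fintype G]
    (hG : (naturalRep G).IsIrreducible) (π : Matrix (Fin d) (Fin d) ℂ →ₐ[ℂ] A) (x : A) :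
    ((Fintype.card G : ℂ)⁻¹ • ∑ g : G, π (g : (Matrix (Fin d) (Fin d) ℂ)ˣ) * x *
        π ((g⁻¹ : G) : (Matrix (Fin d) (Fin d) ℂ)ˣ)) = matAvg π x := by
  have h := fun i j => avg_conj_eq hG (Matrix.single i j 1)
  calc _ = (Fintype.card G : ℂ)⁻¹ • ∑ g : G, ∑ i, ∑ j, matCoeff π i j x *
        π (((g : (Matrix (Fin d) (Fin d) ℂ)ˣ) : Matrix (Fin d) (Fin d) ℂ) * Matrix.single i j 1 *
          (((g⁻¹ : G) : (Matrix (Fin d) (Fin d) ℂ)ˣ) : Matrix (Fin d) (Fin d) ℂ)) := by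
        congr 1
        refine Finset.sum_congr rfl fun g _ => ?_
        conv_lhs => rw [← sum_matCoeff_mul π x]
        simp only [Finset.mul_sum, Finset.sum_mul]
        refine Finset.sum_congr rfl fun i _ => Finset.sum_congr rfl fun j _ => ?_
        rw [← mul_assoc, ← (commute_matCoeff π i j x _).eq, map_mul, map_mul]
        simp only [mul_assoc]
    _ = ∑ i, ∑ j, matCoeff π i j x * π ((Fintype.card G : ℂ)⁻¹ • ∑ g : G,
          ((g : (Matrix (Fin d) (Fin d) ℂ)ˣ) : Matrix (Fin d) (Fin d) ℂ) * Matrix.single i j 1 *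
          (((g⁻¹ : G) : (Matrix (Fin d) (Fin d) ℂ)ˣ) : Matrix (Fin d) (Fin d) ℂ)) := by
        rw [Finset.sum_comm, Finset.smul_sum]
        refine Finset.sum_congr rfl fun i _ => ?_
        rw [Finset.sum_comm, Finset.smul_sum]
        refine Finset.sum_congr rfl fun j _ => ?_
        rw [map_smul, map_sum, mul_smul_comm, Finset.mul_sum]
    _ = matAvg π x := by
        simp_rw [h, map_smul, map_one, mul_smul_comm, mul_one, matAvg_apply, Finset.smul_sum]
        refine Finset.sum_congr rfl fun i _ => ?_
        rw [Finset.sum_eq_single i]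
        · simp
        · intro j _ hj
          simp [Matrix.trace_single_eq_of_ne _ _ _ (Ne.symm hj)]
        · simp

end Schur

/-! ### Totality of elementary tensors in `L^p` of a product. -/

section Density

/-- A π-λ argument: the sets whose indicators lie in the closure of `V` form a Dynkin system.
Countable disjoint unions are `L^p` limits of finite ones, since `p < ∞` and the measure is finite.
-/
theorem dense_of_indicator_mem {Ω : Type*} [mΩ : MeasurableSpace Ω] {P : Measure Ω}
    [IsFiniteMeasure P] {p : ℝ≥0∞} [Fact (1 ≤ p)] (hp : p ≠ ∞) (V : Submodule ℂ (Lp ℂ p P))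
    (C : Set (Set Ω)) (hgen : mΩ = MeasurableSpace.generateFrom C) (hpi : IsPiSystem C)
    (huniv : Set.univ ∈ C)
    (hV : ∀ s ∈ C, ∀ hs : MeasurableSet s,
      indicatorConstLp p hs (measure_ne_top P s) (1 : ℂ) ∈ V) :
    Dense (V : Set (Lp ℂ p P)) := by
  have key : ∀ s, ∀ hs : MeasurableSet s,
      indicatorConstLp p hs (measure_ne_top P s) (1 : ℂ) ∈ V.topologicalClosure := by
    refine MeasurableSpace.induction_on_inter hgen hpi ?_ ?_ ?_ ?_
    · rw [indicatorConstLp_empty]; exact Submodule.zero_mem _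
    · exact fun t ht => V.le_topologicalClosure (hV t ht _)
    · intro t ht h
      have h1 : indicatorConstLp p ht.compl (measure_ne_top P _) (1 : ℂ)
          = indicatorConstLp p MeasurableSet.univ (measure_ne_top P _) 1
            - indicatorConstLp p ht (measure_ne_top P _) 1 := by
        rw [eq_sub_iff_add_eq, ← indicatorConstLp_disjoint_union]
        · congr 1; simp
        · exact disjoint_compl_left
      rw [h1]
      exact Submodule.sub_mem _ (V.le_topologicalClosure (hV _ huniv _)) h
    · intro f hd hf h
      have hm : ∀ n, MeasurableSet (⋃ i ∈ Finset.range n, f i) := fun n =>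
        Finset.measurableSet_biUnion _ fun i _ => hf i
      have hfin : ∀ n, indicatorConstLp p (hm n) (measure_ne_top P _) (1 : ℂ)
          ∈ V.topologicalClosure := by
        intro n
        induction n with
        | zero => simp
        | succ n ih =>
          have hdis : Disjoint (f n) (⋃ i ∈ Finset.range n, f i) := by
            simp only [Set.disjoint_iUnion_right, Finset.mem_range]
            exact fun i hi => hd hi.ne'
          have := Submodule.add_mem _ (h n) ih
          rw [← indicatorConstLp_disjoint_union _ _ _ _ hdis] at this
          convert this using 2
          rw [Finset.range_add_one, Finset.set_biUnion_insert]
      refine (Submodule.isClosed_topologicalClosure V).mem_of_tendsto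
        (tendsto_indicatorConstLp_set hp (l := Filter.atTop) ?_)
        (Filter.Eventually.of_forall hfin)
      have hsub : ∀ n, ⋃ i ∈ Finset.range n, f i ⊆ ⋃ i, f i := fun n =>
        Set.iUnion₂_subset fun i _ => Set.subset_iUnion f i
      have heq : ∀ n, symmDiff (⋃ i ∈ Finset.range n, f i) (⋃ i, f i)
          = (⋃ i, f i) \ ⋃ i ∈ Finset.range n, f i := fun n => by
        rw [Set.symmDiff_def, Set.sdiff_eq_empty.2 (hsub n), Set.empty_union]
      simp_rw [heq]
      have hanti : Antitone fun n => (⋃ i, f i) \ ⋃ i ∈ Finset.range n, f i := by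
        intro m n hmn
        refine Set.sdiff_subset_sdiff_right (Set.biUnion_subset_biUnion_left ?_)
        exact Finset.range_mono hmn
      have hempty : ⋂ n, ((⋃ i, f i) \ ⋃ i ∈ Finset.range n, f i) = ∅ := by
        ext x
        simp only [Set.mem_iInter, Set.mem_sdiff, Set.mem_iUnion, Finset.mem_range,
          Set.mem_empty_iff_false, iff_false]
        intro hx
        obtain ⟨i, hi⟩ := (hx 0).1
        exact (hx (i + 1)).2 ⟨i, by omega, hi⟩
      have := tendsto_measure_iInter_atTop (μ := P)
        (fun n => ((MeasurableSet.iUnion hf).diff (hm n)).nullMeasurableSet) hanti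
        ⟨0, measure_ne_top _ _⟩
      rwa [hempty, measure_empty] at this
  have htop : ∀ f : Lp ℂ p P, f ∈ V.topologicalClosure := by
    refine Lp.induction hp _ ?_ ?_ ?_
    · intro c s hs hμs
      have : (Lp.simpleFunc.indicatorConst p hs hμs.ne c : Lp ℂ p P)
          = c • indicatorConstLp p hs (measure_ne_top P s) (1 : ℂ) := by
        rw [Lp.simpleFunc.coe_indicatorConst]
        apply Lp.ext
        filter_upwards [indicatorConstLp_coeFn (p := p) (hs := hs) (hμs := hμs.ne) (c := c),
          indicatorConstLp_coeFn (p := p) (hs := hs) (hμs := hμs.ne) (c := (1 : ℂ)),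
          Lp.coeFn_smul c (indicatorConstLp p hs (measure_ne_top P s) (1 : ℂ))] with x h1 h2 h3
        rw [h1, h3, Pi.smul_apply, h2]
        by_cases hx : x ∈ s <;> simp [hx]
      rw [this]
      exact Submodule.smul_mem _ _ (key s hs)
    · exact fun f g _ _ _ h1 h2 => Submodule.add_mem _ h1 h2
    · exact Submodule.isClosed_topologicalClosure V
  exact fun f => htop f

variable {ι : Type*} {X : ι → Type*} [∀ i, MeasurableSpace (X i)]
  {p : ℝ≥0∞} [Fact (1 ≤ p)] {μ : ∀ i, Measure (X i)} [∀ i, IsProbabilityMeasure (μ i)]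

theorem measurePreserving_compl (S : Finset ι) :
    MeasurePreserving (fun (x : ∀ i, X i) (i : {i // i ∉ S}) => x i) (Measure.infinitePi μ)
      (Measure.infinitePi fun i : {i // i ∉ S} => μ i) := by
  classical
  exact measurePreserving_snd.comp (measurePreserving_split (μ := μ) S)

theorem coeFn_tensorVec (S : Finset ι) (ξ : ∀ i : {i // i ∈ S}, Lp ℂ p (μ i))
    (η : Lp ℂ p (Measure.infinitePi fun i : {i // i ∉ S} => μ i)) :
    tensorVec S ξ η =ᵐ[Measure.infinitePi μ]
      fun x => (∏ i : {i // i ∈ S}, ξ i (x i)) * η (fun i => x i) :=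
  MemLp.coeFn_toLp _

/-- The elementary tensors are total in `L^p` of a product of probability spaces. -/
theorem dense_span_tensorVec (hp : p ≠ ∞) (S : Finset ι) :
    Dense (Submodule.span ℂ (Set.range fun z : (∀ i : {i // i ∈ S}, Lp ℂ p (μ i)) ×
      Lp ℂ p (Measure.infinitePi fun i : {i // i ∉ S} => μ i) => tensorVec S z.1 z.2) :
      Set (Lp ℂ p (Measure.infinitePi μ))) := by
  classical
  refine dense_of_indicator_mem hp _ _ generateFrom_squareCylinders.symm
    (isPiSystem_squareCylinders (fun _ => MeasurableSpace.isPiSystem_measurableSet) (by simp [MeasurableSet.univ])) ?_ ?_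
  · exact ⟨∅, fun _ => Set.univ, by simp, by simp⟩
  rintro _ ⟨s, t, ht, rfl⟩ hs
  simp only [Set.mem_univ_pi, Set.mem_ofPred_eq] at ht
  -- The cylinder constrains only the coordinates in `s`; a coordinate of `S` outside `s` gets the
  -- whole space and contributes the factor 1.
  let t' : ∀ i, Set (X i) := fun i => if i ∈ s then t i else Set.univ
  have ht' : ∀ i, MeasurableSet (t' i) := fun i => by
    dsimp only [t']; split_ifs
    · exact ht i
    · exact MeasurableSet.univ
  let u : Set (∀ i : {i // i ∉ S}, X i) := (s.subtype (· ∉ S) : Set {i // i ∉ S}).pi fun i => t i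
  have hu : MeasurableSet u := MeasurableSet.pi (Finset.countable_toSet _) fun i _ => ht i
  refine Submodule.subset_span ⟨⟨fun i => indicatorConstLp p (ht' i) (measure_ne_top _ _) 1,
    indicatorConstLp p hu (measure_ne_top _ _) 1⟩, ?_⟩
  apply Lp.ext
  have h1 : ∀ i : {i // i ∈ S}, ∀ᵐ x ∂Measure.infinitePi μ,
      (indicatorConstLp p (ht' i) (measure_ne_top (μ i) _) (1 : ℂ) : X i → ℂ) (x i)
        = (t' i).indicator (fun _ => 1) (x i) := fun i =>
    (measurePreserving_eval_infinitePi μ i).quasiMeasurePreserving.ae indicatorConstLp_coeFn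
  have h2 := (measurePreserving_compl (μ := μ) S).quasiMeasurePreserving.ae
    (indicatorConstLp_coeFn (p := p) (hs := hu) (hμs := measure_ne_top _ _) (c := (1 : ℂ)))
  filter_upwards [ae_all_iff.2 h1, h2, coeFn_tensorVec S
    (fun i => indicatorConstLp p (ht' i) (measure_ne_top (μ i) _) (1 : ℂ))
    (indicatorConstLp p hu (measure_ne_top _ _) 1),
    indicatorConstLp_coeFn (p := p) (hs := hs) (hμs := measure_ne_top (Measure.infinitePi μ) _)
      (c := (1 : ℂ))] with x h1 h2 h3 h4
  refine h3.trans (Eq.trans ?_ h4.symm)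
  rw [h2, Finset.prod_congr rfl fun i _ => h1 i]
  by_cases hx : x ∈ (s : Set ι).pi t
  · rw [Set.indicator_of_mem hx, Set.indicator_of_mem, mul_one]
    · refine Finset.prod_eq_one fun i _ => Set.indicator_of_mem ?_ _
      dsimp only [t']
      split_ifs with h
      · exact hx i h
      · trivial
    · intro i hi
      exact hx i (by simpa using hi)
  · rw [Set.indicator_of_notMem hx]
    have : ∃ i ∈ s, x i ∉ t i := by simpa [Set.mem_pi] using hx
    obtain ⟨i, his, hi⟩ := this
    by_cases hiS : i ∈ S
    · rw [Finset.prod_eq_zero (Finset.mem_univ (⟨i, hiS⟩ : {i // i ∈ S})), zero_mul]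
      exact Set.indicator_of_notMem (by simpa [t', his] using hi) _
    · rw [Set.indicator_of_notMem, mul_zero]
      intro hxu
      exact hi (hxu ⟨i, hiS⟩ (by simpa using his))

end Density

/-! ### The operators `T ⊗ 1` acting on one coordinate. -/

section Amplification

theorem enorm_rpow_eq_lintegral {Ω : Type*} [MeasurableSpace Ω] {P : Measure Ω} {p : ℝ≥0∞}
    [Fact (1 ≤ p)] (hp : p ≠ ∞) (f : Lp ℂ p P) :
    ‖f‖ₑ ^ p.toReal = ∫⁻ x, ‖f x‖ₑ ^ p.toReal ∂P := by
  have h0 : p ≠ 0 := (zero_lt_one.trans_le (Fact.out : 1 ≤ p)).ne'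
  rw [Lp.enorm_def, eLpNorm_eq_lintegral_rpow_enorm_toReal h0 hp, ← ENNReal.rpow_mul,
    one_div_mul_cancel (ENNReal.toReal_pos h0 hp).ne', ENNReal.rpow_one]

theorem coeFn_lp_sum {Ω κ : Type*} [MeasurableSpace Ω] {P : Measure Ω} {p : ℝ≥0∞}
    (s : Finset κ) (c : κ → ℂ) (f : κ → Lp ℂ p P) :
    (∑ k ∈ s, c k • f k : Lp ℂ p P) =ᵐ[P] fun x => ∑ k ∈ s, c k * f k x := by
  classical
  induction s using Finset.induction_on with
  | empty => exact Lp.coeFn_zero ℂ p P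
  | insert a s ha ih =>
    rw [Finset.sum_insert ha]
    filter_upwards [ih, Lp.coeFn_add (c a • f a) (∑ k ∈ s, c k • f k), Lp.coeFn_smul (c a) (f a)]
      with x h1 h2 h3
    rw [h2, Pi.add_apply, h1, h3, Finset.sum_insert ha]
    rfl

/-- The Fubini estimate behind `‖T ⊗ 1‖ ≤ ‖T‖`. -/
theorem lintegral_map_prod_le {α β κ : Type*} [MeasurableSpace α] [MeasurableSpace β]
    {μ : Measure α} {ν : Measure β} [SFinite μ] [SFinite ν] {p : ℝ≥0∞} [Fact (1 ≤ p)] (hp : p ≠ ∞)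
    (T : Lp ℂ p μ →L[ℂ] Lp ℂ p μ) (s : Finset κ) (f : κ → Lp ℂ p μ) (h : κ → β → ℂ)
    (hh : ∀ k, Measurable (h k)) :
    ∫⁻ z, ‖∑ k ∈ s, T (f k) z.1 * h k z.2‖ₑ ^ p.toReal ∂(μ.prod ν)
      ≤ ‖T‖ₑ ^ p.toReal * ∫⁻ z, ‖∑ k ∈ s, f k z.1 * h k z.2‖ₑ ^ p.toReal ∂(μ.prod ν) := by
  have hmeas : ∀ g : κ → Lp ℂ p μ,
      Measurable fun z : α × β => ‖∑ k ∈ s, g k z.1 * h k z.2‖ₑ ^ p.toReal := by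
    intro g
    have : Measurable fun z : α × β => ∑ k ∈ s, g k z.1 * h k z.2 :=
      Finset.measurable_fun_sum _ fun k _ =>
        ((Lp.stronglyMeasurable (g k)).measurable.comp measurable_fst).mul
          ((hh k).comp measurable_snd)
    exact this.enorm.pow_const _
  have hslice : ∀ (g : κ → Lp ℂ p μ) (y : β),
      ∫⁻ x, ‖∑ k ∈ s, g k x * h k y‖ₑ ^ p.toReal ∂μ = ‖∑ k ∈ s, h k y • g k‖ₑ ^ p.toReal := by
    intro g y
    rw [enorm_rpow_eq_lintegral hp]
    refine lintegral_congr_ae ?_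
    filter_upwards [coeFn_lp_sum s (fun k => h k y) g] with x hx
    rw [hx]
    simp_rw [mul_comm]
  -- With the second variable fixed, the sum is `T` applied to a single vector of `L^p(μ)`, so the
  -- bound by `‖T‖` holds slice by slice.
  rw [lintegral_prod_symm' _ (hmeas _), lintegral_prod_symm' _ (hmeas _),
    ← lintegral_const_mul _ (hmeas f).lintegral_prod_left']
  refine lintegral_mono fun y => ?_
  rw [hslice (fun k => T (f k)) y, hslice f y, ← ENNReal.mul_rpow_of_nonneg _ _ ENNReal.toReal_nonneg]
  refine ENNReal.rpow_le_rpow ?_ ENNReal.toReal_nonneg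
  simp_rw [← map_smul, ← map_sum]
  exact T.le_opENorm _

variable {ι : Type*} {X : ι → Type*} [∀ i, MeasurableSpace (X i)]
  {p : ℝ≥0∞} [Fact (1 ≤ p)] {μ : ∀ i, Measure (X i)} [∀ i, IsProbabilityMeasure (μ i)]

theorem measurePreserving_slice (n : ι) :
    MeasurePreserving (fun x : ∀ i, X i => (x n, fun i : {i // i ∉ ({n} : Finset ι)} => x i))
      (Measure.infinitePi μ)
      ((μ n).prod (Measure.infinitePi fun i : {i // i ∉ ({n} : Finset ι)} => μ i)) := by
  classical
  exact ((measurePreserving_eval_infinitePi (fun i : {i // i ∈ ({n} : Finset ι)} => μ i)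
    ⟨n, Finset.mem_singleton_self n⟩).prod (MeasurePreserving.id _)).comp
    (measurePreserving_split (μ := μ) {n})

theorem memLp_coordTensor (n : ι) (f : Lp ℂ p (μ n))
    (η : Lp ℂ p (Measure.infinitePi fun i : {i // i ∉ ({n} : Finset ι)} => μ i)) :
    MemLp (fun x : ∀ i, X i => f (x n) * η (fun i => x i)) p (Measure.infinitePi μ) :=
  (memLp_mul_prod (zero_lt_one.trans_le (Fact.out : 1 ≤ p)).ne' (Lp.memLp f)
    (Lp.memLp η)).comp_measurePreserving (measurePreserving_slice n)

/-- The tensor of a function of the coordinate `n` and a function of the other coordinates. -/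
def coordTensor (n : ι) (f : Lp ℂ p (μ n))
    (η : Lp ℂ p (Measure.infinitePi fun i : {i // i ∉ ({n} : Finset ι)} => μ i)) :
    Lp ℂ p (Measure.infinitePi μ) :=
  (memLp_coordTensor n f η).toLp _

theorem coeFn_coordTensor (n : ι) (f : Lp ℂ p (μ n))
    (η : Lp ℂ p (Measure.infinitePi fun i : {i // i ∉ ({n} : Finset ι)} => μ i)) :
    coordTensor n f η =ᵐ[Measure.infinitePi μ] fun x => f (x n) * η (fun i => x i) :=
  MemLp.coeFn_toLp _

theorem coordTensor_smul_add (n : ι) (c : ℂ) (f g : Lp ℂ p (μ n))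
    (η : Lp ℂ p (Measure.infinitePi fun i : {i // i ∉ ({n} : Finset ι)} => μ i)) :
    coordTensor n (c • f + g) η = c • coordTensor n f η + coordTensor n g η := by
  apply Lp.ext
  have hq := (measurePreserving_eval_infinitePi μ n).quasiMeasurePreserving
  filter_upwards [coeFn_coordTensor n (c • f + g) η, coeFn_coordTensor n f η,
    coeFn_coordTensor n g η, hq.ae (Lp.coeFn_add (c • f) g), hq.ae (Lp.coeFn_smul c f),
    Lp.coeFn_add (c • coordTensor n f η) (coordTensor n g η),
    Lp.coeFn_smul c (coordTensor n f η)] with x h1 h2 h3 h4 h5 h6 h7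
  dsimp only [Function.eval] at h4 h5
  rw [h1, h6, Pi.add_apply, h7, Pi.smul_apply, h2, h3, h4, Pi.add_apply, h5, Pi.smul_apply,
    smul_eq_mul, smul_eq_mul]
  ring

/-- An elementary tensor over `S ∋ n` is the tensor of its component at `n` with a function of the
other coordinates. -/
theorem exists_tensorVec_update_eq_coordTensor [DecidableEq ι] {S : Finset ι} {n : ι}
    (hn : n ∈ S) (ξ : ∀ i : {i // i ∈ S}, Lp ℂ p (μ i))
    (η : Lp ℂ p (Measure.infinitePi fun i : {i // i ∉ S} => μ i)) :
    ∃ η' : Lp ℂ p (Measure.infinitePi fun i : {i // i ∉ ({n} : Finset ι)} => μ i),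
      ∀ f : Lp ℂ p (μ n), tensorVec S (Function.update ξ ⟨n, hn⟩ f) η = coordTensor n f η' := by
  let h : (∀ i : {i // i ∉ ({n} : Finset ι)}, X i) → ℂ := fun y =>
    (∏ i ∈ (Finset.univ.erase (⟨n, hn⟩ : {i // i ∈ S})).attach,
      ξ i.1 (y ⟨i.1, by
        have := Finset.ne_of_mem_erase i.2
        intro h
        exact this (Subtype.ext (Finset.mem_singleton.1 h))⟩)) *
      η fun i => y ⟨i, by
        intro h
        rw [Finset.mem_singleton] at h
        exact i.2 (h ▸ hn)⟩
  have hh : Measurable h := by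
    refine Measurable.mul ?_ ?_
    · refine Finset.measurable_fun_prod _ fun i _ => ?_
      exact (Lp.stronglyMeasurable (ξ i.1)).measurable.comp (measurable_pi_apply _)
    · exact (Lp.stronglyMeasurable η).measurable.comp
        (measurable_pi_lambda _ fun i => measurable_pi_apply _)
  have hfun : ∀ (f : Lp ℂ p (μ n)) (x : ∀ i, X i),
      (∏ i : {i // i ∈ S}, (Function.update ξ ⟨n, hn⟩ f i : Lp ℂ p (μ i)) (x i)) *
        η (fun i => x i) = f (x n) * h (fun i => x i) := by
    intro f x
    rw [← Finset.mul_prod_erase _ _ (Finset.mem_univ (⟨n, hn⟩ : {i // i ∈ S})),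
      Function.update_self, ← Finset.prod_attach, mul_assoc]
    congr 2
    refine Finset.prod_congr rfl fun i _ => ?_
    rw [Function.update_of_ne (Finset.ne_of_mem_erase i.2)]
  have hmem : MemLp h p (Measure.infinitePi fun i : {i // i ∉ ({n} : Finset ι)} => μ i) := by
    have hc := measurePreserving_compl (μ := μ) {n}
    refine ⟨hh.aestronglyMeasurable, ?_⟩
    rw [← eLpNorm_comp_measurePreserving hh.aestronglyMeasurable hc]
    -- Putting the constant 1 in slot `n` turns the elementary tensor into `h`, which is how `h`
    -- inherits membership in `L^p`.
    have hone := (measurePreserving_eval_infinitePi μ n).quasiMeasurePreserving.ae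
      (Lp.coeFn_const p (μ n) (1 : ℂ))
    refine ((memLp_tensor S (Function.update ξ ⟨n, hn⟩ (Lp.const p (μ n) (1 : ℂ))) η).ae_eq ?_).2
    filter_upwards [hone] with x hx
    dsimp only [Function.eval] at hx
    rw [hfun, hx, Function.const_apply, one_mul]
    rfl
  refine ⟨hmem.toLp h, fun f => Lp.ext ?_⟩
  filter_upwards [coeFn_tensorVec S (Function.update ξ ⟨n, hn⟩ f) η,
    coeFn_coordTensor n f (hmem.toLp h),
    (measurePreserving_compl (μ := μ) {n}).quasiMeasurePreserving.ae hmem.coeFn_toLp]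
    with x h1 h2 h3
  rw [h1, h2, h3, hfun]

theorem continuousLinearMap_ext_tensorVec (hp : p ≠ ∞) (S : Finset ι)
    {c c' : Lp ℂ p (Measure.infinitePi μ) →L[ℂ] Lp ℂ p (Measure.infinitePi μ)}
    (h : ∀ ξ η, c (tensorVec S ξ η) = c' (tensorVec S ξ η)) : c = c' := by
  refine ContinuousLinearMap.ext_on (dense_span_tensorVec hp S) ?_
  rintro _ ⟨z, rfl⟩
  exact h z.1 z.2

theorem dense_span_coordTensor (hp : p ≠ ∞) (n : ι) :
    Dense (Submodule.span ℂ (Set.range fun z : Lp ℂ p (μ n) ×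
      Lp ℂ p (Measure.infinitePi fun i : {i // i ∉ ({n} : Finset ι)} => μ i) =>
        coordTensor n z.1 z.2) : Set (Lp ℂ p (Measure.infinitePi μ))) := by
  classical
  refine (dense_span_tensorVec hp {n}).mono (Submodule.span_mono ?_)
  rintro _ ⟨z, rfl⟩
  obtain ⟨η', h⟩ := exists_tensorVec_update_eq_coordTensor (Finset.mem_singleton_self n) z.1 z.2
  refine ⟨(z.1 ⟨n, Finset.mem_singleton_self n⟩, η'), ?_⟩
  dsimp only
  rw [← h, Function.update_eq_self]

/-- Working with formal combinations, this one estimate shows both that `T ⊗ 1` is well defined on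
the span of tensors and that it is bounded by `‖T‖`. -/
theorem norm_linearCombination_coordTensor_le (hp : p ≠ ∞) (n : ι)
    (T : Lp ℂ p (μ n) →L[ℂ] Lp ℂ p (μ n))
    (x : Lp ℂ p (μ n) ×
      Lp ℂ p (Measure.infinitePi fun i : {i // i ∉ ({n} : Finset ι)} => μ i) →₀ ℂ) :
    ‖Finsupp.linearCombination ℂ (fun z : Lp ℂ p (μ n) × _ => coordTensor n (T z.1) z.2) x‖
      ≤ ‖T‖ * ‖Finsupp.linearCombination ℂ
        (fun z : Lp ℂ p (μ n) × _ => coordTensor n z.1 z.2) x‖ := by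
  have h0 : p ≠ 0 := (zero_lt_one.trans_le (Fact.out : 1 ≤ p)).ne'
  have hpos := ENNReal.toReal_pos h0 hp
  -- Used for `g = T` and for `g = id`, the two sides of the Fubini estimate.
  have hcomp : ∀ g : Lp ℂ p (μ n) → Lp ℂ p (μ n),
      ‖Finsupp.linearCombination ℂ (fun z : Lp ℂ p (μ n) × _ => coordTensor n (g z.1) z.2) x‖ₑ
        ^ p.toReal = ∫⁻ z, ‖∑ k ∈ x.support, g k.1 z.1 * (x k * k.2 z.2)‖ₑ ^ p.toReal
          ∂((μ n).prod (Measure.infinitePi fun i : {i // i ∉ ({n} : Finset ι)} => μ i)) := by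
    intro g
    have hm : Measurable fun z : X n × (∀ i : {i // i ∉ ({n} : Finset ι)}, X i) =>
        ∑ k ∈ x.support, g k.1 z.1 * (x k * k.2 z.2) :=
      Finset.measurable_fun_sum _ fun k _ =>
        ((Lp.stronglyMeasurable (g k.1)).measurable.comp measurable_fst).mul
          (((Lp.stronglyMeasurable k.2).measurable.comp measurable_snd).const_mul _)
    rw [enorm_rpow_eq_lintegral hp,
      ← (measurePreserving_slice (μ := μ) n).lintegral_comp (hm.enorm.pow_const _)]
    refine lintegral_congr_ae ?_
    have hall : ∀ᵐ y ∂Measure.infinitePi μ, ∀ k ∈ x.support,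
        coordTensor n (g k.1) k.2 y = g k.1 (y n) * k.2 (fun i => y i) :=
      (Filter.eventually_all_finset _).2 fun k _ => coeFn_coordTensor n (g k.1) k.2
    rw [Finsupp.linearCombination_apply, Finsupp.sum]
    filter_upwards [coeFn_lp_sum x.support x fun k => coordTensor n (g k.1) k.2, hall]
      with y hy hk
    rw [hy, Finset.sum_congr rfl fun k hks => by rw [hk k hks]]
    simp only [mul_left_comm]
  have hle := lintegral_map_prod_le
    (ν := Measure.infinitePi fun i : {i // i ∉ ({n} : Finset ι)} => μ i) hp T x.support
    (fun k => k.1) (fun k y => x k * k.2 y)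
    fun k => (Lp.stronglyMeasurable k.2).measurable.const_mul _
  have hid := hcomp id
  simp only [id] at hid
  rw [← hcomp T, ← hid, ← ENNReal.mul_rpow_of_nonneg _ _ hpos.le,
    ENNReal.rpow_le_rpow_iff hpos] at hle
  have := ENNReal.toReal_mono (ENNReal.mul_ne_top enorm_ne_top enorm_ne_top) hle
  simpa [ENNReal.toReal_mul] using this

theorem denseRange_linearCombination_coordTensor (hp : p ≠ ∞) (n : ι) :
    DenseRange (Finsupp.linearCombination ℂ (fun z : Lp ℂ p (μ n) ×
      Lp ℂ p (Measure.infinitePi fun i : {i // i ∉ ({n} : Finset ι)} => μ i) =>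
        coordTensor n z.1 z.2)) := by
  have := dense_span_coordTensor (μ := μ) hp n
  rw [← Finsupp.range_linearCombination] at this
  exact this

/-- The operator `T ⊗ 1` on `L^p` of a product, with `T` acting on the coordinate `n`. -/
def ampL (n : ι) (T : Lp ℂ p (μ n) →L[ℂ] Lp ℂ p (μ n)) :
    Lp ℂ p (Measure.infinitePi μ) →L[ℂ] Lp ℂ p (Measure.infinitePi μ) :=
  LinearMap.extendOfNorm
    (Finsupp.linearCombination ℂ (fun z : Lp ℂ p (μ n) ×
      Lp ℂ p (Measure.infinitePi fun i : {i // i ∉ ({n} : Finset ι)} => μ i) =>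
        coordTensor n (T z.1) z.2))
    (Finsupp.linearCombination ℂ fun z => coordTensor n z.1 z.2)

theorem ampL_coordTensor (hp : p ≠ ∞) (n : ι) (T : Lp ℂ p (μ n) →L[ℂ] Lp ℂ p (μ n))
    (f : Lp ℂ p (μ n))
    (η : Lp ℂ p (Measure.infinitePi fun i : {i // i ∉ ({n} : Finset ι)} => μ i)) :
    ampL n T (coordTensor n f η) = coordTensor n (T f) η := by
  have := LinearMap.extendOfNorm_eq (denseRange_linearCombination_coordTensor hp n)
    ⟨‖T‖, norm_linearCombination_coordTensor_le hp n T⟩ (Finsupp.single (f, η) 1)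
  simpa [ampL] using this

theorem norm_ampL_le (hp : p ≠ ∞) (n : ι) (T : Lp ℂ p (μ n) →L[ℂ] Lp ℂ p (μ n)) :
    ‖ampL n T‖ ≤ ‖T‖ :=
  ContinuousLinearMap.opNorm_le_bound _ (norm_nonneg _)
    (LinearMap.norm_extendOfNorm_apply_le (denseRange_linearCombination_coordTensor hp n) _
      (norm_linearCombination_coordTensor_le hp n T))

theorem continuousLinearMap_ext_coordTensor (hp : p ≠ ∞) (n : ι)
    {c c' : Lp ℂ p (Measure.infinitePi μ) →L[ℂ] Lp ℂ p (Measure.infinitePi μ)}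
    (h : ∀ f η, c (coordTensor n f η) = c' (coordTensor n f η)) : c = c' := by
  refine ContinuousLinearMap.ext_on (dense_span_coordTensor hp n) ?_
  rintro _ ⟨z, rfl⟩
  exact h z.1 z.2

/-- `T ↦ T ⊗ 1` as an algebra homomorphism. -/
def ampHom (hp : p ≠ ∞) (n : ι) : (Lp ℂ p (μ n) →L[ℂ] Lp ℂ p (μ n)) →ₐ[ℂ]
    (Lp ℂ p (Measure.infinitePi μ) →L[ℂ] Lp ℂ p (Measure.infinitePi μ)) :=
  AlgHom.ofLinearMap
    (IsLinearMap.mk' (ampL n) (by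
      have key : ∀ (c : ℂ) (T T' : Lp ℂ p (μ n) →L[ℂ] Lp ℂ p (μ n)),
          ampL (μ := μ) n (c • T + T') = c • ampL n T + ampL n T' := by
        intro c T T'
        refine continuousLinearMap_ext_coordTensor hp n fun f η => ?_
        simp [ampL_coordTensor hp, coordTensor_smul_add]
      have hzero : ampL (μ := μ) n (0 : Lp ℂ p (μ n) →L[ℂ] Lp ℂ p (μ n)) = 0 := by
        simpa using key 1 0 0
      exact ⟨fun T T' => by simpa using key 1 T T', fun c T => by simpa [hzero] using key c T 0⟩))
    (continuousLinearMap_ext_coordTensor hp n fun f η => by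
      change ampL n _ _ = _
      rw [ampL_coordTensor hp]; rfl)
    (fun T T' => continuousLinearMap_ext_coordTensor hp n fun f η => by
      change ampL n _ _ = ampL n T (ampL n T' _)
      simp only [ampL_coordTensor hp]; rfl)

theorem norm_ampHom_le (hp : p ≠ ∞) (n : ι) (T : Lp ℂ p (μ n) →L[ℂ] Lp ℂ p (μ n)) :
    ‖ampHom hp n T‖ ≤ ‖T‖ := norm_ampL_le hp n T

theorem ampHom_tensorVec (hp : p ≠ ∞) [DecidableEq ι] {S : Finset ι} {n : ι} (hn : n ∈ S)
    (T : Lp ℂ p (μ n) →L[ℂ] Lp ℂ p (μ n)) (ξ : ∀ i : {i // i ∈ S}, Lp ℂ p (μ i))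
    (η : Lp ℂ p (Measure.infinitePi fun i : {i // i ∉ S} => μ i)) :
    ampHom hp n T (tensorVec S ξ η)
      = tensorVec S (Function.update ξ ⟨n, hn⟩ (T (ξ ⟨n, hn⟩))) η := by
  obtain ⟨η', h⟩ := exists_tensorVec_update_eq_coordTensor hn ξ η
  rw [h, ← ampL_coordTensor hp, ← h, Function.update_eq_self]
  rfl

/-- On elementary tensors over `{m, n}` the two operators change different factors, and these
tensors are total. -/
theorem commute_ampHom (hp : p ≠ ∞) {m n : ι} (hmn : m ≠ n)
    (T : Lp ℂ p (μ m) →L[ℂ] Lp ℂ p (μ m)) (T' : Lp ℂ p (μ n) →L[ℂ] Lp ℂ p (μ n)) :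
    Commute (ampHom (μ := μ) hp m T) (ampHom hp n T') := by
  classical
  have hm : m ∈ ({m, n} : Finset ι) := by simp
  have hn : n ∈ ({m, n} : Finset ι) := by simp
  have hne : (⟨m, hm⟩ : {i // i ∈ ({m, n} : Finset ι)}) ≠ ⟨n, hn⟩ := fun h =>
    hmn (congrArg Subtype.val h)
  refine continuousLinearMap_ext_tensorVec hp {m, n} fun ξ η => ?_
  change ampHom hp m T (ampHom hp n T' _) = ampHom hp n T' (ampHom hp m T _)
  rw [ampHom_tensorVec hp hn, ampHom_tensorVec hp hm, ampHom_tensorVec hp hm,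
    ampHom_tensorVec hp hn, Function.update_of_ne hne, Function.update_of_ne hne.symm,
    Function.update_comm hne]

end Amplification

/-! ### Decomposition of `L^p` along a countable partition. -/

section IndicatorOperators

variable {Ω : Type*} [MeasurableSpace Ω] {P : Measure Ω} {p : ℝ≥0∞} [Fact (1 ≤ p)]

/-- Multiplication by the indicator function of `s` as an operator on `L^p`. -/
def indicatorL (P : Measure Ω) (p : ℝ≥0∞) [Fact (1 ≤ p)] {s : Set Ω} (hs : MeasurableSet s) :
    Lp ℂ p P →L[ℂ] Lp ℂ p P :=
  LinearMap.mkContinuous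
    { toFun := fun f => ((Lp.memLp f).indicator hs).toLp _
      map_add' := fun f g => by
        apply Lp.ext
        filter_upwards [((Lp.memLp (f + g)).indicator hs).coeFn_toLp,
          ((Lp.memLp f).indicator hs).coeFn_toLp, ((Lp.memLp g).indicator hs).coeFn_toLp,
          Lp.coeFn_add f g, Lp.coeFn_add (((Lp.memLp f).indicator hs).toLp _)
            (((Lp.memLp g).indicator hs).toLp _)] with x h1 h2 h3 h4 h5
        rw [h1, h5, Pi.add_apply, h2, h3]
        by_cases hx : x ∈ s
        · simp only [Set.indicator_of_mem hx]; exact h4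
        · simp [hx]
      map_smul' := fun c f => by
        apply Lp.ext
        filter_upwards [((Lp.memLp (c • f)).indicator hs).coeFn_toLp,
          ((Lp.memLp f).indicator hs).coeFn_toLp,
          Lp.coeFn_smul c f, Lp.coeFn_smul c (((Lp.memLp f).indicator hs).toLp _)]
          with x h1 h2 h3 h4
        rw [h1, RingHom.id_apply, h4, Pi.smul_apply, h2]
        by_cases hx : x ∈ s <;> simp [hx, h3] }
    1 (fun f => by
      rw [one_mul]
      refine Lp.norm_le_norm_of_ae_le ?_
      filter_upwards [((Lp.memLp f).indicator hs).coeFn_toLp] with x hx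
      exact (congrArg norm hx).trans_le (norm_indicator_le_norm_self _ _))

theorem coeFn_indicatorL {s : Set Ω} (hs : MeasurableSet s) (f : Lp ℂ p P) :
    indicatorL P p hs f =ᵐ[P] s.indicator f :=
  ((Lp.memLp f).indicator hs).coeFn_toLp

theorem norm_indicatorL_le {s : Set Ω} (hs : MeasurableSet s) : ‖indicatorL P p hs‖ ≤ 1 :=
  LinearMap.mkContinuous_norm_le _ zero_le_one _

theorem indicatorL_mem_lpOn {s : Set Ω} (hs : MeasurableSet s) (f : Lp ℂ p P) :
    indicatorL P p hs f ∈ lpOn p P s := by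
  change ∀ᵐ x ∂P, x ∉ s → _
  filter_upwards [coeFn_indicatorL hs f] with x hx hxs
  rw [hx, Set.indicator_of_notMem hxs]

theorem indicatorL_of_mem_lpOn {s : Set Ω} (hs : MeasurableSet s) {f : Lp ℂ p P}
    (hf : f ∈ lpOn p P s) : indicatorL P p hs f = f := by
  apply Lp.ext
  filter_upwards [coeFn_indicatorL hs f, (hf : ∀ᵐ x ∂P, x ∉ s → f x = 0)] with x hx hxs
  rw [hx]
  by_cases h : x ∈ s
  · rw [Set.indicator_of_mem h]
  · rw [Set.indicator_of_notMem h, hxs h]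

theorem indicatorL_idem {s : Set Ω} (hs : MeasurableSet s) (f : Lp ℂ p P) :
    indicatorL P p hs (indicatorL P p hs f) = indicatorL P p hs f :=
  indicatorL_of_mem_lpOn hs (indicatorL_mem_lpOn hs f)

theorem indicatorL_indicatorL_of_disjoint {s t : Set Ω} (hs : MeasurableSet s)
    (ht : MeasurableSet t) (h : Disjoint s t) (f : Lp ℂ p P) :
    indicatorL P p hs (indicatorL P p ht f) = 0 := by
  apply Lp.ext
  filter_upwards [coeFn_indicatorL hs (indicatorL P p ht f), coeFn_indicatorL ht f,
    Lp.coeFn_zero ℂ p P] with x h1 h2 h3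
  rw [h1, h3, Pi.zero_apply]
  by_cases hx : x ∈ s
  · rw [Set.indicator_of_mem hx, h2, Set.indicator_of_notMem (Set.disjoint_left.1 h hx)]
  · rw [Set.indicator_of_notMem hx]

variable {κ : Type*} {Y : κ → Set Ω}

theorem enorm_rpow_eq_tsum [Countable κ] (hp : p ≠ ∞) (hY : ∀ i, MeasurableSet (Y i))
    (hd : Pairwise fun i j => Disjoint (Y i) (Y j)) (hU : ⋃ i, Y i = Set.univ)
    (f : Lp ℂ p P) :
    ‖f‖ₑ ^ p.toReal = ∑' i, ‖indicatorL P p (hY i) f‖ₑ ^ p.toReal := by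
  have hpos := ENNReal.toReal_pos (zero_lt_one.trans_le (Fact.out : 1 ≤ p)).ne' hp
  rw [enorm_rpow_eq_lintegral hp, ← setLIntegral_univ, ← hU, lintegral_iUnion hY hd]
  refine tsum_congr fun i => ?_
  rw [enorm_rpow_eq_lintegral hp, ← lintegral_indicator (hY i)]
  refine lintegral_congr_ae ?_
  filter_upwards [coeFn_indicatorL (hY i) f] with x hx
  rw [hx]
  by_cases h : x ∈ Y i <;> simp [h, hpos]

theorem indicatorL_sum_indicatorL [DecidableEq κ] (hY : ∀ i, MeasurableSet (Y i))
    (hd : Pairwise fun i j => Disjoint (Y i) (Y j)) (F : Finset κ) (j : κ) (g : κ → Lp ℂ p P)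
    (hg : ∀ i, indicatorL P p (hY i) (g i) = g i) :
    indicatorL P p (hY j) (∑ i ∈ F, g i) = if j ∈ F then g j else 0 := by
  have : ∀ i, indicatorL P p (hY j) (g i) = if j = i then g j else 0 := by
    intro i
    split_ifs with h
    · subst h; exact hg j
    · rw [← hg i, indicatorL_indicatorL_of_disjoint _ _ (hd h)]
  rw [map_sum, Finset.sum_congr rfl fun i _ => this i, Finset.sum_ite_eq]

theorem hasSum_indicatorL [Countable κ] (hp : p ≠ ∞) (hY : ∀ i, MeasurableSet (Y i))
    (hd : Pairwise fun i j => Disjoint (Y i) (Y j)) (hU : ⋃ i, Y i = Set.univ)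
    (f : Lp ℂ p P) : HasSum (fun i => indicatorL P p (hY i) f) f := by
  classical
  have hpos := ENNReal.toReal_pos (zero_lt_one.trans_le (Fact.out : 1 ≤ p)).ne' hp
  have hfin : ∑' i, ‖indicatorL P p (hY i) f‖ₑ ^ p.toReal ≠ ∞ := by
    rw [← enorm_rpow_eq_tsum hp hY hd hU]
    exact ENNReal.rpow_ne_top_of_nonneg hpos.le enorm_ne_top
  have hlim := ENNReal.tendsto_tsum_compl_atTop_zero hfin
  -- The `p`-th power of the error of a partial sum is the tail of a convergent series.
  have heq : ∀ F : Finset κ, ∑' i : {i // i ∉ F}, ‖indicatorL P p (hY i) f‖ₑ ^ p.toReal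
      = ‖f - ∑ i ∈ F, indicatorL P p (hY i) f‖ₑ ^ p.toReal := by
    intro F
    rw [enorm_rpow_eq_tsum hp hY hd hU]
    refine (tsum_subtype {i | i ∉ F} fun i => ‖indicatorL P p (hY i) f‖ₑ ^ p.toReal).trans ?_
    refine tsum_congr fun j => ?_
    rw [map_sub, indicatorL_sum_indicatorL hY hd F j _ fun i => indicatorL_idem (hY i) f]
    by_cases hj : j ∈ F <;> simp [hj, hpos]
  simp_rw [heq] at hlim
  have hlim' := (ENNReal.continuous_rpow_const (y := p.toReal⁻¹)).continuousAt.tendsto.comp hlim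
  simp only [Function.comp_def, ENNReal.rpow_rpow_inv hpos.ne',
    ENNReal.zero_rpow_of_pos (inv_pos.2 hpos)] at hlim'
  rw [HasSum, SummationFilter.unconditional_filter, tendsto_iff_edist_tendsto_0]
  refine hlim'.congr fun F => ?_
  rw [edist_comm, edist_eq_enorm_sub]

/-- An operator leaving invariant the pieces of a countable partition is bounded by the supremum of
the norms of its restrictions. -/
theorem norm_le_of_partition [Countable κ] (hp : p ≠ ∞) (hY : ∀ i, MeasurableSet (Y i))
    (hd : Pairwise fun i j => Disjoint (Y i) (Y j)) (hU : ⋃ i, Y i = Set.univ)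
    (c : Lp ℂ p P →L[ℂ] Lp ℂ p P) {M : ℝ} (hM : 0 ≤ M)
    (hinv : ∀ i f, indicatorL P p (hY i) (c (indicatorL P p (hY i) f))
      = c (indicatorL P p (hY i) f))
    (hle : ∀ i f, ‖c (indicatorL P p (hY i) f)‖ ≤ M * ‖indicatorL P p (hY i) f‖) : ‖c‖ ≤ M := by
  classical
  have hpos := ENNReal.toReal_pos (zero_lt_one.trans_le (Fact.out : 1 ≤ p)).ne' hp
  refine c.opNorm_le_bound hM fun f => ?_
  have hlim := ((hasSum_indicatorL hp hY hd hU f).mapL c).norm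
  refine le_of_tendsto hlim (Filter.Eventually.of_forall fun F => ?_)
  -- By invariance the images of the pieces of `f` remain in their own pieces, so the `p`-th powers
  -- of their norms add.
  have henorm : ‖∑ i ∈ F, c (indicatorL P p (hY i) f)‖ₑ ^ p.toReal
      ≤ (ENNReal.ofReal M * ‖f‖ₑ) ^ p.toReal := by
    rw [ENNReal.mul_rpow_of_nonneg _ _ hpos.le, enorm_rpow_eq_tsum hp hY hd hU,
      enorm_rpow_eq_tsum hp hY hd hU f, ← ENNReal.tsum_mul_left]
    refine ENNReal.tsum_le_tsum fun j => ?_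
    rw [indicatorL_sum_indicatorL hY hd F j _ fun i => hinv i f,
      ← ENNReal.mul_rpow_of_nonneg _ _ hpos.le]
    split_ifs
    · refine ENNReal.rpow_le_rpow ?_ hpos.le
      rw [← ofReal_norm, ← ofReal_norm, ← ENNReal.ofReal_mul hM]
      exact ENNReal.ofReal_le_ofReal (hle j f)
    · simp [hpos]
  rw [ENNReal.rpow_le_rpow_iff hpos, ← ofReal_norm, ← ofReal_norm, ← ENNReal.ofReal_mul hM] at henorm
  exact (ENNReal.ofReal_le_ofReal_iff (by positivity)).1 henorm

end IndicatorOperators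

/-! ### Averages compressed to an invariant subspace. -/

section Corner

variable {A : Type*} [NormedRing A] [NormedAlgebra ℂ A]

/-- The elements that leave the range of the idempotent `q` invariant. -/
def invariantSubalgebra (q : A) (hq : q * q = q) : Subalgebra ℂ A where
  carrier := {a | q * a * q = a * q}
  mul_mem' := by
    intro a b ha hb
    simp only [Set.mem_ofPred_eq] at *
    calc q * (a * b) * q = q * a * (b * q) := by simp only [mul_assoc]
      _ = (q * a * q) * b * q := by rw [← hb]; simp only [mul_assoc]
      _ = a * b * q := by rw [ha, mul_assoc a, mul_assoc a, hb, mul_assoc]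
  add_mem' := by
    intro a b ha hb
    simp only [Set.mem_ofPred_eq] at *
    rw [mul_add, add_mul, add_mul, ha, hb]
  algebraMap_mem' := by
    intro r
    simp only [Set.mem_ofPred_eq]
    rw [← Algebra.commutes, mul_assoc, hq]

theorem mem_invariantSubalgebra {q : A} {hq : q * q = q} {a : A} :
    a ∈ invariantSubalgebra q hq ↔ q * a * q = a * q := Iff.rfl

theorem isClosed_invariantSubalgebra (q : A) (hq : q * q = q) :
    IsClosed (invariantSubalgebra q hq : Set A) :=
  isClosed_eq (f := fun a => q * a * q) (g := fun a => a * q) (by fun_prop) (by fun_prop)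

theorem matAvg_mem_subalgebra {d : ℕ} {π : Matrix (Fin d) (Fin d) ℂ →ₐ[ℂ] A} {B : Subalgebra ℂ A}
    (hπ : ∀ b, π b ∈ B) {a : A} (ha : a ∈ B) : matAvg π a ∈ B := by
  rw [matAvg_apply]
  refine B.smul_mem (B.sum_mem fun i _ => ?_) _
  rw [matCoeff_apply]
  exact B.sum_mem fun s _ => B.mul_mem (B.mul_mem (hπ _) ha) (hπ _)

/-- Invariance lets `q` be inserted between the factors: `π(g) a π(g⁻¹) q = (π(g) q) a (π(g⁻¹) q)`.
Only the norms of `π(g) q` matter, so the group may be chosen to suit `q`. -/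
theorem norm_matAvg_mul_le {d : ℕ} {π : Matrix (Fin d) (Fin d) ℂ →ₐ[ℂ] A} {q : A}
    (hq : q * q = q) (hπ : ∀ b, π b ∈ invariantSubalgebra q hq)
    {G : Subgroup (Matrix (Fin d) (Fin d) ℂ)ˣ} [Finite G]
    (hG : (naturalRep G).IsIrreducible)
    (hG1 : ∀ g ∈ G, ‖π (g : Matrix (Fin d) (Fin d) ℂ) * q‖ ≤ 1)
    {a : A} (ha : a ∈ invariantSubalgebra q hq) : ‖matAvg π a * q‖ ≤ ‖a‖ := by
  have := Fintype.ofFinite G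
  have hterm : ∀ g : G, π (g : (Matrix (Fin d) (Fin d) ℂ)ˣ) * a *
        π ((g⁻¹ : G) : (Matrix (Fin d) (Fin d) ℂ)ˣ) * q
      = (π (g : (Matrix (Fin d) (Fin d) ℂ)ˣ) * q) * a *
        (π ((g⁻¹ : G) : (Matrix (Fin d) (Fin d) ℂ)ˣ) * q) := by
    intro g
    generalize π (g : (Matrix (Fin d) (Fin d) ℂ)ˣ) = x
    have hy := hπ ((g⁻¹ : G) : (Matrix (Fin d) (Fin d) ℂ)ˣ)
    generalize π ((g⁻¹ : G) : (Matrix (Fin d) (Fin d) ℂ)ˣ) = y at hy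
    rw [mem_invariantSubalgebra] at hy ha
    calc x * a * y * q = x * a * (y * q) := mul_assoc _ _ _
      _ = x * (a * q) * (y * q) := by
          conv_lhs => rw [← hy]
          simp only [mul_assoc]
      _ = x * q * a * (q * y * q) := by rw [← ha]; simp only [mul_assoc]
      _ = x * q * a * (y * q) := by rw [hy]
  have hcard : (Fintype.card G : ℝ) ≠ 0 := by exact_mod_cast Fintype.card_ne_zero
  rw [← avg_conj_map_eq hG π a, smul_mul_assoc, Finset.sum_mul,
    Finset.sum_congr rfl fun g _ => hterm g]
  refine (norm_smul_le _ _).trans ?_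
  have hsum : ‖∑ g : G, (π (g : (Matrix (Fin d) (Fin d) ℂ)ˣ) * q) * a *
        (π ((g⁻¹ : G) : (Matrix (Fin d) (Fin d) ℂ)ˣ) * q)‖ ≤ ∑ _g : G, ‖a‖ := by
    refine norm_sum_le_of_le _ fun g _ => ?_
    refine (norm_mul_le _ _).trans ((mul_le_mul (norm_mul_le _ _) (hG1 _ (g⁻¹ : G).2)
      (norm_nonneg _) (by positivity)).trans ?_)
    rw [mul_one]
    exact mul_le_of_le_one_left (norm_nonneg _) (hG1 _ g.2)
  rw [Finset.sum_const, Finset.card_univ, nsmul_eq_mul] at hsum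
  refine (mul_le_mul_of_nonneg_left hsum (norm_nonneg _)).trans_eq ?_
  rw [norm_inv, Complex.norm_natCast, inv_mul_cancel_left₀ hcard]

end Corner

/-! ### Contractive averages from local isometries. -/

section LocalAverages

variable {ι : Type*} {X : ι → Type*} [∀ i, MeasurableSpace (X i)]
  {p : ℝ≥0∞} [Fact (1 ≤ p)] {μ : ∀ i, Measure (X i)} [∀ i, IsProbabilityMeasure (μ i)]

theorem ampHom_indicatorL (hp : p ≠ ∞) (n : ι) {s : Set (X n)} (hs : MeasurableSet s) :
    ampHom hp n (indicatorL (μ n) p hs)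
      = indicatorL (Measure.infinitePi μ) p (measurable_pi_apply n hs) := by
  refine continuousLinearMap_ext_coordTensor hp n fun f η => ?_
  change ampL n _ _ = _
  rw [ampL_coordTensor hp]
  apply Lp.ext
  filter_upwards [coeFn_coordTensor n (indicatorL (μ n) p hs f) η, coeFn_coordTensor n f η,
    coeFn_indicatorL (P := Measure.infinitePi μ) (measurable_pi_apply n hs) (coordTensor n f η),
    (measurePreserving_eval_infinitePi μ n).quasiMeasurePreserving.ae (coeFn_indicatorL hs f)]
    with x h1 h2 h3 h4
  dsimp only [Function.eval] at h4
  rw [h1, h3, h4]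
  by_cases hx : x n ∈ s
  · rw [Set.indicator_of_mem hx, Set.indicator_of_mem (by exact hx), h2]
  · rw [Set.indicator_of_notMem hx, Set.indicator_of_notMem (by exact hx), zero_mul]

theorem indicatorL_mul_self {Ω : Type*} [MeasurableSpace Ω] {P : Measure Ω} {s : Set Ω}
    (hs : MeasurableSet s) : indicatorL P p hs * indicatorL P p hs = indicatorL P p hs :=
  ContinuousLinearMap.ext fun f => indicatorL_idem hs f

/-- If `ρ` locally has enough isometries, then the averages over `ρ ⊗ 1` are contractive on each
algebra of operators leaving invariant the subspaces that come from the coordinate `n`. -/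
theorem norm_matAvg_le (hp : p ≠ ∞) (n : ι) {d : ℕ}
    {ρ : Matrix (Fin d) (Fin d) ℂ →ₐ[ℂ] (Lp ℂ p (μ n) →L[ℂ] Lp ℂ p (μ n))}
    (hρ : LocallyHasEnoughIsometries ρ)
    {B : Subalgebra ℂ (Lp ℂ p (Measure.infinitePi μ) →L[ℂ] Lp ℂ p (Measure.infinitePi μ))}
    (hB : ∀ (s : Set (X n)) (hs : MeasurableSet s),
      (∀ b, indicatorL (μ n) p hs * ρ b * indicatorL (μ n) p hs = ρ b * indicatorL (μ n) p hs) →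
      B ≤ invariantSubalgebra _ (indicatorL_mul_self (p := p) (P := Measure.infinitePi μ)
        (measurable_pi_apply n hs)))
    {a : Lp ℂ p (Measure.infinitePi μ) →L[ℂ] Lp ℂ p (Measure.infinitePi μ)} (ha : a ∈ B) :
    ‖matAvg ((ampHom hp n).comp ρ) a‖ ≤ ‖a‖ := by
  obtain ⟨κ, _, Y, hY, hd, hU, -, hloc⟩ := hρ
  have hinvρ : ∀ i b, indicatorL (μ n) p (hY i) * ρ b * indicatorL (μ n) p (hY i)
      = ρ b * indicatorL (μ n) p (hY i) := by
    intro i b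
    obtain ⟨h, -⟩ := hloc i
    exact ContinuousLinearMap.ext fun f =>
      indicatorL_of_mem_lpOn (hY i) (h b _ (indicatorL_mem_lpOn (hY i) f))
  have hπ : ∀ i b, (ampHom hp n).comp ρ b ∈ invariantSubalgebra _
      (indicatorL_mul_self (p := p) (P := Measure.infinitePi μ)
        (measurable_pi_apply n (hY i))) := by
    intro i b
    rw [mem_invariantSubalgebra, ← ampHom_indicatorL hp, AlgHom.comp_apply, ← map_mul, ← map_mul,
      ← map_mul, hinvρ i b]
  have hnorm : ∀ i, ‖matAvg ((ampHom hp n).comp ρ) a *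
      indicatorL (Measure.infinitePi μ) p (measurable_pi_apply n (hY i))‖ ≤ ‖a‖ := by
    intro i
    -- The group depends on `i`, while the average it computes does not.
    obtain ⟨h, G, hfin, hirr, hG⟩ := hloc i
    refine norm_matAvg_mul_le (indicatorL_mul_self _) (hπ i) hirr (fun g hg => ?_)
      (hB _ (hY i) (hinvρ i) ha)
    rw [← ampHom_indicatorL hp n (hY i), AlgHom.comp_apply, ← map_mul]
    refine (norm_ampHom_le hp n _).trans (ContinuousLinearMap.opNorm_le_bound _ zero_le_one
      fun f => ?_)
    -- The isometry hypothesis concerns the restriction to the piece, so it is applied to the part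
    -- of `f` supported there; cutting off does not increase the norm.
    have h1 := (restrictRep ρ (lpOn p (μ n) (Y i)) h g).le_opNorm
      ⟨_, indicatorL_mem_lpOn (hY i) f⟩
    rw [hG g hg, one_mul] at h1
    rw [one_mul]
    refine le_trans h1 (((indicatorL (μ n) p (hY i)).le_opNorm f).trans ?_)
    exact mul_le_of_le_one_left (norm_nonneg _) (norm_indicatorL_le _)
  refine norm_le_of_partition hp (fun i => measurable_pi_apply n (hY i)) ?_ ?_ _ (norm_nonneg _)
    ?_ ?_
  · exact fun i j hij => (hd hij).preimage _
  · rw [← Set.preimage_iUnion, hU, Set.preimage_univ]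
  · intro i f
    have := mem_invariantSubalgebra.1 (matAvg_mem_subalgebra (hπ i) (hB _ (hY i) (hinvρ i) ha))
    exact congrArg (fun c => c f) this
  · intro i f
    have := (matAvg ((ampHom hp n).comp ρ) a *
      indicatorL (Measure.infinitePi μ) p (measurable_pi_apply n (hY i))).le_of_opNorm_le (hnorm i)
      (indicatorL _ p (measurable_pi_apply n (hY i)) f)
    rwa [mul_apply_eq_comp, indicatorL_idem] at this

end LocalAverages

/-! ### The tower inside `A(d, ρ)` and its simplicity. -/

namespace TensorData

variable {p : ℝ≥0∞} [Fact (1 ≤ p)] (D : TensorData.{v} p) (hp : p ≠ ∞)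

/-- The representation `ρ n` acting on the coordinate `n` of the product. -/
def coordRep (n : ℕ) :
    Matrix (Fin (D.d n)) (Fin (D.d n)) ℂ →ₐ[ℂ] (D.LpProd →L[ℂ] D.LpProd) :=
  (ampHom (μ := D.μ) hp n).comp (D.ρ n)

theorem coordRep_tensorVec {S : Finset ℕ} {n : ℕ} (hn : n ∈ S)
    (b : Matrix (Fin (D.d n)) (Fin (D.d n)) ℂ) (ξ : ∀ i : {i // i ∈ S}, Lp ℂ p (D.μ i))
    (η : Lp ℂ p (Measure.infinitePi fun i : {i // i ∉ S} => D.μ i)) :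
    D.coordRep hp n b (tensorVec S ξ η)
      = tensorVec S (Function.update ξ ⟨n, hn⟩ (D.ρ n b (ξ ⟨n, hn⟩))) η :=
  ampHom_tensorVec hp hn _ ξ η

theorem commute_coordRep {m n : ℕ} (hmn : m ≠ n) (a : Matrix (Fin (D.d m)) (Fin (D.d m)) ℂ)
    (b : Matrix (Fin (D.d n)) (Fin (D.d n)) ℂ) :
    Commute (D.coordRep hp m a) (D.coordRep hp n b) :=
  commute_ampHom hp hmn _ _

theorem coordRep_mem_algebra (n : ℕ) (b : Matrix (Fin (D.d n)) (Fin (D.d n)) ℂ) :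
    D.coordRep hp n b ∈ D.algebra := by
  refine Subalgebra.le_topologicalClosure _
    (le_iSup (fun n => D.stage (Finset.range n)) (n + 1) ?_)
  have hn : n ∈ Finset.range (n + 1) := Finset.self_mem_range_succ n
  refine Submodule.subset_span
    -- The elementary tensor with `b` at coordinate `n` and the identity matrix elsewhere.
    ⟨Function.update (fun _ => 1) (⟨n, hn⟩ : {i // i ∈ Finset.range (n + 1)}) b, fun ξ η => ?_⟩
  rw [coordRep_tensorVec D hp hn]
  congr 1
  funext i
  by_cases h : i = ⟨n, hn⟩
  · subst h; simp
  · rw [Function.update_of_ne h]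
    simp [Function.update_of_ne h]

/-- The product `(⨂_{k < n} ρ k (a k)) ⊗ 1`. -/
def prodRep (a : ∀ n, Matrix (Fin (D.d n)) (Fin (D.d n)) ℂ) :
    ℕ → (D.LpProd →L[ℂ] D.LpProd)
  | 0 => 1
  | n + 1 => D.coordRep hp n (a n) * prodRep a n

/-- The set of tensor factors is held at `N` while `n` grows, so that the induction stays among
tensors of one fixed shape. -/
theorem prodRep_tensorVec (a : ∀ n, Matrix (Fin (D.d n)) (Fin (D.d n)) ℂ) (N n : ℕ) (h : n ≤ N)
    (ξ : ∀ i : {i // i ∈ Finset.range N}, Lp ℂ p (D.μ i))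
    (η : Lp ℂ p (Measure.infinitePi fun i : {i // i ∉ Finset.range N} => D.μ i)) :
    D.prodRep hp a n (tensorVec (Finset.range N) ξ η)
      = tensorVec (Finset.range N)
        (fun i => if (i : ℕ) < n then D.ρ i (a i) (ξ i) else ξ i) η := by
  induction n with
  | zero => simp [prodRep]
  | succ n ih =>
    have hn : n ∈ Finset.range N := Finset.mem_range.2 h
    change D.coordRep hp n (a n) (D.prodRep hp a n _) = _
    rw [ih (by omega), coordRep_tensorVec D hp hn]
    congr 1
    funext i
    by_cases hi : i = ⟨n, hn⟩
    · subst hi; simp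
    · have hi' : (i : ℕ) ≠ n := fun h => hi (Subtype.ext h)
      rw [Function.update_of_ne hi]
      have : (i : ℕ) < n + 1 ↔ (i : ℕ) < n := by omega
      simp only [this]

theorem exists_eq_prodRep_of_mem_elementary {n : ℕ} {c : D.LpProd →L[ℂ] D.LpProd}
    (hc : c ∈ D.elementary (Finset.range n)) :
    ∃ a, c = D.prodRep hp a n := by
  obtain ⟨a, ha⟩ := hc
  -- The value 0 is immaterial: the product of length `n` uses only indices below `n`.
  refine ⟨fun k => if h : k ∈ Finset.range n then a ⟨k, h⟩ else 0,
    continuousLinearMap_ext_tensorVec hp (Finset.range n) fun ξ η => ?_⟩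
  rw [ha, prodRep_tensorVec D hp _ n n le_rfl]
  congr 1
  funext i
  have h := Finset.mem_range.1 i.2
  simp [h]

/-- The representation `coordRep` with values in the algebra `A(d, ρ)`. -/
def coordHom (n : ℕ) : Matrix (Fin (D.d n)) (Fin (D.d n)) ℂ →ₐ[ℂ] D.algebra :=
  (D.coordRep hp n).codRestrict D.algebra (D.coordRep_mem_algebra hp n)

theorem commute_coordHom (m n : ℕ) (hmn : m ≠ n) (a : Matrix (Fin (D.d m)) (Fin (D.d m)) ℂ)
    (b : Matrix (Fin (D.d n)) (Fin (D.d n)) ℂ) :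
    Commute (D.coordHom hp m a) (D.coordHom hp n b) :=
  Subtype.ext (D.commute_coordRep hp hmn a b).eq

theorem coe_matAvg_coordHom (n : ℕ) (x : D.algebra) :
    (matAvg (D.coordHom hp n) x : D.LpProd →L[ℂ] D.LpProd) = matAvg (D.coordRep hp n) x := by
  simp [matAvg_apply, matCoeff_apply, coordHom]

theorem prodRep_mem_map_matTower (a : ∀ n, Matrix (Fin (D.d n)) (Fin (D.d n)) ℂ) (n : ℕ) :
    D.prodRep hp a n ∈ (matTower (D.coordHom hp) n).map D.algebra.val := by
  induction n with
  | zero => exact Subalgebra.one_mem _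
  | succ n ih =>
    refine Subalgebra.mul_mem _ ⟨D.coordHom hp n (a n), ?_, rfl⟩ (Subalgebra.map_mono ?_ ih)
    · exact map_mem_matTower _ (D.commute_coordHom hp) (Nat.lt_succ_self n) _
    · exact matTower_mono _ (D.commute_coordHom hp) n.le_succ

/-- Each elementary tensor is a product of coordinate representations, so the stages lie in the
tower; density needs only this inclusion. -/
theorem dense_iUnion_matTower :
    Dense (⋃ n, (matTower (D.coordHom hp) n : Set D.algebra)) := by
  have hdir : Directed (· ≤ ·) fun n => (matTower (D.coordHom hp) n).map D.algebra.val :=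
    (show Monotone fun n => (matTower (D.coordHom hp) n).map D.algebra.val from
      fun m n h => Subalgebra.map_mono (matTower_mono _ (D.commute_coordHom hp) h)).directed_le
  have hle : ⨆ n, D.stage (Finset.range n)
      ≤ ⨆ n, (matTower (D.coordHom hp) n).map D.algebra.val := by
    refine iSup_mono fun n => ?_
    have : Submodule.span ℂ (D.elementary (Finset.range n))
        ≤ Subalgebra.toSubmodule ((matTower (D.coordHom hp) n).map D.algebra.val) := by
      refine Submodule.span_le.2 fun c hc => ?_
      obtain ⟨a, rfl⟩ := D.exists_eq_prodRep_of_mem_elementary hp hc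
      exact D.prodRep_mem_map_matTower hp a n
    exact this
  intro x
  rw [Metric.mem_closure_iff]
  intro ε hε
  have hx : (x : D.LpProd →L[ℂ] D.LpProd) ∈
      closure ((⨆ n, D.stage (Finset.range n) : Subalgebra ℂ _) : Set _) := x.2
  obtain ⟨b, hb, hxb⟩ := Metric.mem_closure_iff.1 hx ε hε
  have hb' := hle hb
  rw [← SetLike.mem_coe, Subalgebra.coe_iSup_of_directed hdir, Set.mem_iUnion] at hb'
  obtain ⟨n, y, hy, rfl⟩ := hb'
  exact ⟨y, Set.mem_iUnion.2 ⟨n, hy⟩, hxb⟩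

theorem algebra_le_of_coordRep_mem
    {B : Subalgebra ℂ (D.LpProd →L[ℂ] D.LpProd)} (hB : IsClosed (B : Set (D.LpProd →L[ℂ] D.LpProd)))
    (h : ∀ n b, D.coordRep hp n b ∈ B) : D.algebra ≤ B := by
  refine Subalgebra.topologicalClosure_minimal (iSup_le fun n => ?_) hB
  have : Submodule.span ℂ (D.elementary (Finset.range n)) ≤ Subalgebra.toSubmodule B := by
    refine Submodule.span_le.2 fun c hc => ?_
    obtain ⟨a, rfl⟩ := D.exists_eq_prodRep_of_mem_elementary hp hc
    have hmem : ∀ n, D.prodRep hp a n ∈ B := by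
      intro n
      induction n with
      | zero => exact B.one_mem
      | succ n ih => exact B.mul_mem (h n _) ih
    exact hmem n
  exact this

theorem norm_matAvg_coordHom_le (hD : ∀ n, LocallyHasEnoughIsometries (D.ρ n)) (n : ℕ)
    (x : D.algebra) : ‖matAvg (D.coordHom hp n) x‖ ≤ ‖x‖ := by
  change ‖(matAvg (D.coordHom hp n) x : D.LpProd →L[ℂ] D.LpProd)‖
    ≤ ‖(x : D.LpProd →L[ℂ] D.LpProd)‖
  rw [coe_matAvg_coordHom]
  refine norm_matAvg_le hp n (hD n) (B := D.algebra) (fun s hs hinv => ?_) x.2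
  -- The invariant subalgebra is closed, so generators suffice: coordinate `n` is covered by `hinv`,
  -- and every other coordinate commutes with the indicator.
  refine D.algebra_le_of_coordRep_mem hp (isClosed_invariantSubalgebra _ _) fun k b => ?_
  rw [mem_invariantSubalgebra, ← ampHom_indicatorL hp n hs]
  by_cases hk : k = n
  · subst hk
    rw [coordRep, AlgHom.comp_apply, ← map_mul, ← map_mul, ← map_mul, hinv b]
  · have hcomm : Commute (D.coordRep hp k b) (ampHom hp n (indicatorL (D.μ n) p hs)) :=
      commute_ampHom hp hk _ _
    rw [← hcomm.eq, mul_assoc, ← map_mul, indicatorL_mul_self]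

instance : Nontrivial D.algebra := by
  have : Nontrivial D.LpProd := by
    refine ⟨Lp.const p _ 1, 0, fun h => ?_⟩
    have h1 := Lp.norm_const (p := p) (μ := Measure.infinitePi D.μ) (c := (1 : ℂ))
      (zero_lt_one.trans_le (Fact.out : 1 ≤ p)).ne'
    rw [h] at h1
    simp at h1
  infer_instance

include hp in
theorem isSimpleRing_algebra (hD : ∀ n, LocallyHasEnoughIsometries (D.ρ n)) :
    IsSimpleRing D.algebra := by
  have : CompleteSpace D.algebra :=
    (Subalgebra.isClosed_topologicalClosure _).completeSpace_coe
  refine isSimpleRing_of_matTower (D.coordHom hp) (D.commute_coordHom hp)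
    (fun n => ?_) (D.norm_matAvg_coordHom_le hp hD) (D.dense_iUnion_matTower hp)
  have := D.two_le_d n
  omega

end TensorData

end LpUHF
end

theorem theoremT {p : ℝ≥0∞} [Fact (1 ≤ p)] (hp : p ≠ ∞)
    {Z : Type u} [MeasurableSpace Z] (ν : Measure Z) [SigmaFinite ν]
    (A : Subalgebra ℂ (Lp ℂ p ν →L[ℂ] Lp ℂ p ν))
    (hA : LpUHF.IsTensorUHFLocallyEnoughIsometries.{u, v} A) :
    IsSimpleRing A := by
  obtain ⟨D, hD, e, -⟩ := hA
  exact IsSimpleRing.of_ringEquiv e.symm.toRingEquiv (D.isSimpleRing_algebra hp hD)
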